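/- Work on the circle $\mathbb{T}=\mathbb{R}/2\pi\mathbb{Z}$ with $\widehat u(k)=\frac1{2\pi}\int_0^{2\pi}u(x)e^{-ikx}\,dx$. For $s\in\mathbb{R}$ put $\|u\|_{H^s}=(2\pi)^{1/2}\big(\sum_{k\in\mathbb{Z}}(1+k^2)^s|\widehat u(k)|^2\big)^{1/2}$, and let $H^s_0$ be the space of real-valued periodic distributions $u$ with $\widehat u(0)=0$ and $\|u\|_{H^s}<\infty$. For $N>0$ and constants $C=(C_j)_{j\ge0}$, call $\beta:\mathbb{R}\to\mathbb{R}$ a bump adapted to $[-N,N]$ (with constants $C$) if $\beta$ is smooth and even, vanishes outside $[-N,N]$, equals $1$ on $[-N/2,N/2]$, and satisfies $|\beta^{(j)}|\le C_jN^{-j}$ for all $j\ge 0$. Let $B$ be the Fourier multiplier $\widehat{Bf}(k)=\beta(k)\widehat f(k)$, let $P_0f=\widehat f(0)$, and let $$M_Bv:=v_x+B(v^2)-P_0(v^2).$$ Let $s\ge-\frac12$, $R>0$, and $C=(C_j)_{j\ge 0}$. There are constants $N_0,L$ and a function $N_1:\mathbb{R}\to\mathbb{R}$, depending only on $s$, $R$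 and $C$, such that for every $N\ge N_0$ and every bump $\beta$ adapted to $[-N,N]$ with constants $C$ there is a map $M_B^{-1}$, defined on the ball $\mathbf{B}=\{u\in H^s_0:\|u\|_{H^s}\le R\}$ with values in $H^{s+1}_0$, that inverts $M_B$ and is Lipschitz: 1. $M_B(M_B^{-1}u)=u$ for all $u\in\mathbf{B}$; 2. $M_B^{-1}(M_Bv)=v$ for every $v\in H^{s+1}_0$ with $M_Bv\in\mathbf{B}$, provided that either $\beta\ge0$, or $\|v\|_{H^{s+1}}\le\rho$ for some $\rho$ with $N\ge N_1(\rho)$; 3. $\|M_B^{-1}u_1-M_B^{-1}u_2\|_{H^{s+1}}\le L\,\|u_1-u_2\|_{H^s}$ for all $u_1,u_2\in\mathbf{B}$. -/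

import Mathlib

open scoped ContDiff ComplexConjugate

namespace TorusSobolev

/-- A periodic distribution on the circle `ℝ / 2πℤ`, given by its Fourier coefficients
`û(k) = (1/2π) ∫₀^{2π} u(x) e^{-ikx} dx`. -/
abbrev Coeffs : Type := ℤ → ℂ

/-- The Sobolev norm `‖u‖_{H^s} = (2π)^{1/2} ‖⟨k⟩^s û(k)‖_{ℓ²}`, where `⟨k⟩ = (1 + k²)^{1/2}`. -/
noncomputable def hsNorm (s : ℝ) (u : Coeffs) : ℝ :=
  √(2 * Real.pi) * √(∑' k : ℤ, (1 + (k : ℝ) ^ 2) ^ s * ‖u k‖ ^ 2)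

/-- `H^s_0`: the real-valued periodic distributions of mean zero with finite `H^s` norm. -/
structure MemHs0 (s : ℝ) (u : Coeffs) : Prop where
  summable : Summable fun k : ℤ => (1 + (k : ℝ) ^ 2) ^ s * ‖u k‖ ^ 2
  real_valued : ∀ k, u (-k) = conj (u k)
  mean_zero : u 0 = 0

/-- The closed ball of radius `R` in `H^s_0`, centred at the origin. -/
def ball (s R : ℝ) : Set Coeffs := {u | MemHs0 s u ∧ hsNorm s u ≤ R}

/-- The derivative: `(u_x)^(k) = i k û(k)`. -/
noncomputable def deriv (u : Coeffs) : Coeffs := fun k => Complex.I * k * u k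

/-- The pointwise product: `(u v)^(k) = ∑_{j} û(j) v̂(k - j)`; the series converges absolutely
when `u` and `v` are square integrable (see `fourierCoeff_mul`). -/
noncomputable def mul (u v : Coeffs) : Coeffs := fun k => ∑' j : ℤ, u j * v (k - j)

/-- The Fourier multiplier with symbol `b`. -/
noncomputable def multiplier (b : ℤ → ℝ) (u : Coeffs) : Coeffs := fun k => b k * u k

/-- The mean `P₀ u`, as a constant function. -/
def mean (u : Coeffs) : Coeffs := fun k => if k = 0 then u k else 0

/-- The modified Miura map `M_B v = v_x + B(v²) - P₀(v²)`, where `B` has symbol `b`. -/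
noncomputable def modifiedMiura (b : ℤ → ℝ) (v : Coeffs) : Coeffs :=
  deriv v + multiplier b (mul v v) - mean (mul v v)

/-- `β` is a real even bump function adapted to `[-N, N]`, with derivative bounds
`|β^{(j)}| ≤ C_j N^{-j}`, that equals `1` on `[-N/2, N/2]`. -/
structure IsAdaptedBump (C : ℕ → ℝ) (N : ℝ) (β : ℝ → ℝ) : Prop where
  smooth : ContDiff ℝ ∞ β
  even : ∀ ξ, β (-ξ) = β ξ
  eq_one : ∀ ξ, |ξ| ≤ N / 2 → β ξ = 1
  eq_zero : ∀ ξ, N < |ξ| → β ξ = 0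
  bound : ∀ (j : ℕ) (ξ : ℝ), |iteratedDeriv j β ξ| ≤ C j / N ^ j

/-- On square integrable functions on a circle, `mul` is the pointwise product. -/
theorem fourierCoeff_mul {T : ℝ} [hT : Fact (0 < T)]
    (f g : MeasureTheory.Lp ℂ 2 (AddCircle.haarAddCircle (T := T))) (k : ℤ) :
    fourierCoeff (fun x => f x * g x) k = mul (fourierCoeff f) (fourierCoeff g) k := by
  have hmem : MeasureTheory.MemLp (fun x => fourier k x * conj (g x)) 2
      (AddCircle.haarAddCircle (T := T)) := by
    refine (MeasureTheory.Lp.memLp g).of_le ?_ (Filter.Eventually.of_forall fun x => ?_)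
    · exact (map_continuous (fourier k)).aestronglyMeasurable.mul
        (Complex.continuous_conj.comp_aestronglyMeasurable
          (MeasureTheory.Lp.aestronglyMeasurable g))
    · simp [fourier_apply, Circle.norm_coe]
  have key := (fourierBasis (T := T)).tsum_inner_mul_inner (hmem.toLp _) f
  have h1 : inner ℂ (hmem.toLp _) f = fourierCoeff (fun x => f x * g x) k := by
    rw [MeasureTheory.L2.inner_def, fourierCoeff]
    refine MeasureTheory.integral_congr_ae ?_
    filter_upwards [hmem.coeFn_toLp] with x hx
    simp only [RCLike.inner_apply, hx, map_mul, Complex.conj_conj, smul_eq_mul, fourier_neg]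
    ring
  have h2 (j : ℤ) : inner ℂ (hmem.toLp _) (fourierBasis j) = fourierCoeff g (k - j) := by
    rw [MeasureTheory.L2.inner_def, fourierCoeff, coe_fourierBasis]
    refine MeasureTheory.integral_congr_ae ?_
    filter_upwards [hmem.coeFn_toLp, coeFn_fourierLp 2 j] with x hx hj
    simp only [RCLike.inner_apply, hx, hj, map_mul, Complex.conj_conj, smul_eq_mul]
    rw [← fourier_neg, ← mul_assoc, ← fourier_add]
    congr 3
    ring
  rw [← h1, ← key]
  refine tsum_congr fun j => ?_
  rw [h2, ← (fourierBasis (T := T)).repr_apply_apply, fourierBasis_repr, mul_comm]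

end TorusSobolev

/-! Applying the mean-zero antiderivative ∂⁻¹ turns M_B v = u into Φ(v) = v + Q(v, v) = y, with y =
∂⁻¹u in H^{s+1}, s + 1 ≥ 1/2, and Q(v, w) = ∂⁻¹B(vw) bounded, symmetric and bilinear. Two bounds,
uniform in N and β, carry the proof.

(a) The linearizations d ↦ d + 2Q(a, d) are bounded below for a in a fixed ball (`exists_bddBelow`).
In L² with B = 1 this is a linear first-order periodic ODE, solved with the integrating factor
exp(2∫a) (`exists_integral_sq_le`). Smoothing by Q lifts the bound to H^{s+1}. Replacing 1 by β only
affects |k| > N/2, where ∂⁻¹ makes the error small. As Φ(v) - Φ(w) is the linearization at the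
midpoint applied to v - w, injectivity and the Lipschitz bound follow.

(b) If the symbol is nonnegative, solutions are bounded a priori (`exists_energy_zero_le`,
`exists_apriori_of_nonneg`). Put v = w + y, so that w_x = -(B(w² + q) - P₀B(w² + q)) with q = 2wy +
y². Since ∫ w² w_x = 0, pairing with w² bounds w_x by q. Then w² is nearly constant: by the equation
at low frequencies, by a tail estimate at high ones. But w has mean zero, hence a zero, so w² cannot
be near a large constant unless w_x is large (`mean_sq_pow_three_le`).

Existence is the method of continuity (`exists_quadratic_eq`): by (a) the image of a ball under Φ is
open, and by (a) and (b) it is relatively closed in the ball of data. If β changes sign, comparison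
with a sharp cutoff still yields (b) for v in a given ball, which is enough for existence;
uniqueness then needs N large in terms of the size of v. -/

namespace TorusSobolev

/-! ### Quadratic equations in a Banach space by the method of continuity. -/

section ContinuityMethod

variable {X : Type*} [NormedAddCommGroup X] [NormedSpace ℝ X]

/-- For a quadratic map the difference quotient is exactly the derivative at the midpoint, so bounds
on linearizations transfer to the map with the same constant. -/
theorem quadratic_sub {Q : X →L[ℝ] X →L[ℝ] X} (hQ : ∀ x y, Q x y = Q y x) (v w : X) :
    (v + Q v v) - (w + Q w w) = (v - w) + (2 : ℝ) • Q ((2⁻¹ : ℝ) • (v + w)) (v - w) := by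
  simp only [map_smul, smul_apply, map_add, map_sub, add_apply, hQ w v]
  module

/-- If the linearizations of `v ↦ v + Q(v, v)` are bounded below on the ball of radius `ρ`, then so
is the map itself. -/
theorem norm_sub_le_of_bddBelow {Q : X →L[ℝ] X →L[ℝ] X} (hQ : ∀ x y, Q x y = Q y x) {ρ K : ℝ}
    (hK : ∀ a, ‖a‖ ≤ ρ → ∀ d, ‖d‖ ≤ K * ‖d + (2 : ℝ) • Q a d‖) {v w : X} (hv : ‖v‖ ≤ ρ)
    (hw : ‖w‖ ≤ ρ) : ‖v - w‖ ≤ K * ‖(v + Q v v) - (w + Q w w)‖ := by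
  rw [quadratic_sub hQ]
  refine hK _ ?_ _
  rw [norm_smul]
  have := norm_add_le v w
  norm_num
  linarith

variable [CompleteSpace X]

/-- An operator that is bounded below and is a limit of invertible operators is invertible. -/
theorem isUnit_of_mem_closure {T : X →L[ℝ] X} {K : ℝ} (hT : T ∈ closure {S : X →L[ℝ] X | IsUnit S})
    (hK : ∀ v, ‖v‖ ≤ K * ‖T v‖) : IsUnit T := by
  wlog hK1 : 1 ≤ K generalizing K
  · refine this (K := max K 1) (fun v => (hK v).trans ?_) (le_max_right _ _)
    gcongr
    exact le_max_left _ _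
  have hK0 : 0 < K := by linarith
  -- At distance 1/(4K) the lower bound passes to `S` with constant 2K, so ‖S⁻¹‖ ≤ 2K and `T` lies
  -- in the ball of radius ‖S⁻¹‖⁻¹ about `S`, which consists of units.
  obtain ⟨S, hS, hd⟩ := Metric.mem_closure_iff.1 hT (1 / (4 * K)) (by positivity)
  obtain ⟨S, rfl⟩ := hS
  rw [dist_eq_norm] at hd
  have hbound (v : X) : ‖v‖ ≤ 2 * K * ‖(S : X →L[ℝ] X) v‖ := by
    have h1 : ‖T v‖ ≤ ‖(S : X →L[ℝ] X) v‖ + 1 / (4 * K) * ‖v‖ := by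
      calc ‖T v‖ = ‖(S : X →L[ℝ] X) v + (T - S) v‖ := by simp
        _ ≤ ‖(S : X →L[ℝ] X) v‖ + ‖(T - S) v‖ := norm_add_le _ _
        _ ≤ _ := by
          gcongr
          exact (ContinuousLinearMap.le_opNorm _ _).trans (by gcongr)
    have h2 := (hK v).trans (mul_le_mul_of_nonneg_left h1 hK0.le)
    have h3 : K * (1 / (4 * K) * ‖v‖) = ‖v‖ / 4 := by field_simp
    have := norm_nonneg v
    rw [mul_add, h3] at h2
    linarith
  have hinv : ‖((S⁻¹ : (X →L[ℝ] X)ˣ) : X →L[ℝ] X)‖ ≤ 2 * K := by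
    refine ContinuousLinearMap.opNorm_le_bound _ (by positivity) fun v => ?_
    have h := hbound (((S⁻¹ : (X →L[ℝ] X)ˣ) : X →L[ℝ] X) v)
    rwa [← mul_apply_eq_comp, Units.mul_inv, one_apply_eq_self] at h
  rcases subsingleton_or_nontrivial X with hX | hX
  · have : T = 1 := Subsingleton.elim _ _
    rw [this]; exact isUnit_one
  refine ⟨Units.ofNearby S T (hd.trans_le ?_), rfl⟩
  calc 1 / (4 * K) ≤ (2 * K)⁻¹ := by
        rw [one_div]; gcongr; linarith
    _ ≤ _ := by
        gcongr
        exact norm_pos_iff.2 (Units.ne_zero _)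

/-- Method of continuity for the linear path `1 + t A`. -/
theorem isUnit_one_add_of_bddBelow (A : X →L[ℝ] X) {K : ℝ}
    (hK : ∀ t ∈ Set.Icc (0 : ℝ) 1, ∀ v, ‖v‖ ≤ K * ‖v + t • A v‖) : IsUnit (1 + A) := by
  have hcont : Continuous fun t : ℝ => 1 + t • A := by fun_prop
  have hsub : Set.Icc (0 : ℝ) 1 ⊆ (fun t : ℝ => 1 + t • A) ⁻¹' {S | IsUnit S} := by
    refine isPreconnected_Icc.subset_of_closure_inter_subset (Units.isOpen.preimage hcont)
      ⟨0, ⟨le_rfl, zero_le_one⟩, by simp⟩ ?_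
    rintro t ⟨ht, ht'⟩
    exact isUnit_of_mem_closure (hcont.closure_preimage_subset _ ht) (K := K)
      fun v => by simpa using hK t ht' v
  simpa using hsub (Set.right_mem_Icc.2 zero_le_one)

/-- Method of continuity for the quadratic equation `v + Q(v, v) = y`. -/
theorem exists_quadratic_eq {Q : X →L[ℝ] X →L[ℝ] X} (hQ : ∀ x y, Q x y = Q y x) {ρ K R : ℝ}
    (hρ : 0 < ρ) (hK : ∀ a, ‖a‖ ≤ ρ → ∀ d, ‖d‖ ≤ K * ‖d + (2 : ℝ) • Q a d‖)
    (hR : ∀ v, ‖v‖ ≤ ρ → ‖v + Q v v‖ ≤ R → ‖v‖ < ρ) {y : X} (hy : ‖y‖ ≤ R) :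
    ∃ v, ‖v‖ < ρ ∧ v + Q v v = y := by
  have hR0 : 0 ≤ R := (norm_nonneg y).trans hy
  let Φ : X → X := fun v => v + Q v v
  have hΦ : Continuous Φ := by fun_prop
  let U : Set X := Φ '' Metric.ball 0 ρ
  have hU : IsOpen U := by
    rw [isOpen_iff_mem_nhds]
    rintro _ ⟨v, hv, rfl⟩
    have hunit : IsUnit (1 + (2 : ℝ) • Q v) := by
      refine isUnit_one_add_of_bddBelow _ (K := K) fun t ht d => ?_
      -- The path 1 + 2tQ(v) is the linearization at t v, which is still in the ball.
      have h := hK (t • v) ?_ d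
      · simpa [smul_smul, mul_comm] using h
      · rw [norm_smul, Real.norm_eq_abs, abs_of_nonneg ht.1]
        rw [mem_ball_zero_iff] at hv
        nlinarith [ht.2, norm_nonneg v]
    have hder : HasStrictFDerivAt Φ (1 + (2 : ℝ) • Q v) v := by
      have h1 := (hasStrictFDerivAt_id (𝕜 := ℝ) v).add
        (HasStrictFDerivAt.comp (g := fun p : X × X => Q p.1 p.2) (f := fun x => (x, x)) v
          (Q.isBoundedBilinearMap.hasStrictFDerivAt (v, v))
          ((hasStrictFDerivAt_id v).prodMk (hasStrictFDerivAt_id v)))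
      refine h1.congr_fderiv ?_
      ext d
      simp [hQ d v, two_smul]
    have hsurj : (1 + (2 : ℝ) • Q v).range = ⊤ := by
      obtain ⟨e, he⟩ := hunit
      rw [LinearMap.range_eq_top]
      intro d
      refine ⟨((e⁻¹ : (X →L[ℝ] X)ˣ) : X →L[ℝ] X) d, ?_⟩
      have := congrArg (fun S : X →L[ℝ] X => S d) (Units.mul_inv e)
      rw [he] at this
      exact this
    have hmap := hder.map_nhds_eq_of_surj hsurj
    rw [← hmap]
    exact Filter.image_mem_map (Metric.isOpen_ball.mem_nhds hv)
  -- The data ball is connected, so it suffices that `U` is open and contains the limits of its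
  -- points that lie in the data ball.
  have hsub : Metric.closedBall (0 : X) R ⊆ U := by
    refine (convex_closedBall (0 : X) R).isPreconnected.subset_of_closure_inter_subset hU
      ⟨0, by simpa using hR0, 0, by simpa using hρ, by simp [Φ]⟩ ?_
    rintro z ⟨hz, hzR⟩
    obtain ⟨f, hf, hlim⟩ := mem_closure_iff_seq_limit.1 hz
    choose g hg hgf using hf
    -- The lower bound makes preimages of a convergent sequence Cauchy; the use of |K| + 1 avoids
    -- any sign assumption on `K`.
    have hcau : CauchySeq g := by
      have hfc : CauchySeq f := hlim.cauchySeq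
      rw [Metric.cauchySeq_iff] at hfc ⊢
      intro ε hε
      obtain ⟨n, hn⟩ := hfc (ε / (|K| + 1)) (by positivity)
      refine ⟨n, fun m hm l hl => ?_⟩
      have h1 := norm_sub_le_of_bddBelow hQ hK (mem_ball_zero_iff.1 (hg m)).le
        (mem_ball_zero_iff.1 (hg l)).le
      have h2 := hn m hm l hl
      rw [← hgf m, ← hgf l, dist_eq_norm, lt_div_iff₀ (by positivity)] at h2
      rw [dist_eq_norm]
      refine lt_of_le_of_lt h1 (lt_of_le_of_lt ?_ h2)
      rw [mul_comm]
      gcongr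
      linarith [le_abs_self K]
    obtain ⟨v, hv⟩ := cauchySeq_tendsto_of_complete hcau
    have hvz : Φ v = z := by
      refine tendsto_nhds_unique ((hΦ.tendsto v).comp hv) ?_
      simpa [Function.comp_def, hgf] using hlim
    have hvρ : ‖v‖ ≤ ρ :=
      le_of_tendsto hv.norm (Filter.Eventually.of_forall fun n => (mem_ball_zero_iff.1 (hg n)).le)
    -- The limit is only known to satisfy ‖v‖ ≤ ρ; the a priori bound `hR` returns it to the open
    -- ball.
    refine ⟨v, mem_ball_zero_iff.2 (hR v hvρ ?_), hvz⟩
    change ‖Φ v‖ ≤ R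
    rw [hvz]
    exact mem_closedBall_zero_iff.1 hzR
  obtain ⟨v, hv, hvy⟩ := hsub (mem_closedBall_zero_iff.2 hy)
  exact ⟨v, mem_ball_zero_iff.1 hv, hvy⟩

end ContinuityMethod

/-! ### Calculus on [0, 2π]: mean-zero functions and a periodic linear ODE. -/

section PeriodicODE

open Real intervalIntegral

/-- Cauchy–Schwarz: t ↦ ∫ (t|f| - |g|)² is a nonnegative quadratic, so its discriminant is
nonpositive. -/
theorem sq_integral_abs_mul_le {f g : ℝ → ℝ} (hf : Continuous f) (hg : Continuous g) {a b : ℝ}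
    (hab : a ≤ b) :
    (∫ x in a..b, |f x * g x|) ^ 2 ≤ (∫ x in a..b, f x ^ 2) * ∫ x in a..b, g x ^ 2 := by
  have key : ∀ t : ℝ, 0 ≤ (∫ x in a..b, f x ^ 2) * (t * t) +
      (-2 * ∫ x in a..b, |f x * g x|) * t + ∫ x in a..b, g x ^ 2 := by
    intro t
    have h : 0 ≤ ∫ x in a..b, (t * |f x| - |g x|) ^ 2 :=
      integral_nonneg hab fun x _ => sq_nonneg _
    have e : (fun x => (t * |f x| - |g x|) ^ 2) =
        fun x => (t * t * f x ^ 2 + (-2 * t) * |f x * g x|) + g x ^ 2 := by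
      ext x
      rw [abs_mul, ← sq_abs (f x), ← sq_abs (g x)]
      ring
    rw [e, integral_add, integral_add, integral_const_mul, integral_const_mul] at h
    · linarith
    all_goals exact Continuous.intervalIntegrable (by fun_prop) _ _
  have h := discrim_le_zero key
  rw [discrim] at h
  linarith

/-- A continuous function takes its mean value. -/
theorem exists_eq_mean {f : ℝ → ℝ} (hf : Continuous f) {c : ℝ}
    (hc : ∫ x in (0 : ℝ)..(2 * π), f x = 2 * π * c) : ∃ x ∈ Set.Icc 0 (2 * π), f x = c := by
  have hpi := Real.two_pi_pos
  by_contra! hne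
  have hint (g : ℝ → ℝ) (hg : Continuous g) (hpos : ∀ x ∈ Set.Icc 0 (2 * π), 0 < g x) :
      0 < ∫ x in (0 : ℝ)..(2 * π), g x :=
    intervalIntegral_pos_of_pos_on (hg.intervalIntegrable _ _)
      (fun x hx => hpos x ⟨hx.1.le, hx.2.le⟩) hpi
  rcases lt_or_gt_of_ne (hne 0 ⟨le_rfl, hpi.le⟩) with h0 | h0
  · have hall : ∀ x ∈ Set.Icc 0 (2 * π), 0 < c - f x := by
      intro x hx
      by_contra! hcx
      obtain ⟨y, hy, hyc⟩ := intermediate_value_Icc hx.1 hf.continuousOn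
        (show c ∈ Set.Icc (f 0) (f x) from ⟨h0.le, by linarith⟩)
      exact hne y ⟨hy.1, hy.2.trans hx.2⟩ hyc
    have h := hint (fun x => c - f x) (continuous_const.sub hf) hall
    rw [integral_sub (continuous_const.intervalIntegrable _ _) (hf.intervalIntegrable _ _), hc] at h
    simp at h
  · have hall : ∀ x ∈ Set.Icc 0 (2 * π), 0 < f x - c := by
      intro x hx
      by_contra! hcx
      obtain ⟨y, hy, hyc⟩ := intermediate_value_Icc' hx.1 hf.continuousOn
        (show c ∈ Set.Icc (f x) (f 0) from ⟨by linarith, h0.le⟩)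
      exact hne y ⟨hy.1, hy.2.trans hx.2⟩ hyc
    have h := hint (fun x => f x - c) (hf.sub continuous_const) hall
    rw [integral_sub (hf.intervalIntegrable _ _) (continuous_const.intervalIntegrable _ _), hc] at h
    simp at h

/-- The oscillation of a function on `[0, 2π]` is at most the total variation. -/
theorem abs_sub_le_integral_abs {F F' : ℝ → ℝ} (hF : ∀ x, HasDerivAt F (F' x) x)
    (hF' : Continuous F') {x y : ℝ} (hx : x ∈ Set.Icc 0 (2 * π)) (hy : y ∈ Set.Icc 0 (2 * π)) :
    |F x - F y| ≤ ∫ t in (0 : ℝ)..(2 * π), |F' t| := by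
  wlog hyx : y ≤ x generalizing x y
  · rw [abs_sub_comm]
    exact this hy hx (le_of_not_ge hyx)
  rw [← integral_eq_sub_of_hasDerivAt (fun t _ => hF t) (hF'.intervalIntegrable _ _)]
  refine (abs_integral_le_integral_abs hyx).trans ?_
  exact integral_mono_interval hy.1 hyx hx.2
    (Filter.Eventually.of_forall fun t => abs_nonneg (F' t)) (hF'.abs.intervalIntegrable _ _)

/-- The square of a function of mean zero is not close to a nonzero constant, unless the derivative
of the function is large. -/
theorem mean_sq_pow_three_le {f f' : ℝ → ℝ} (hf : ∀ x, HasDerivAt f (f' x) x)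
    (hf' : Continuous f') {c : ℝ} (h0 : ∫ x in (0 : ℝ)..(2 * π), f x = 0)
    (hc : ∫ x in (0 : ℝ)..(2 * π), f x ^ 2 = 2 * π * c) :
    4 / 9 * c ^ 3 ≤
      (∫ x in (0 : ℝ)..(2 * π), (f x ^ 2 - c) ^ 2) * ∫ x in (0 : ℝ)..(2 * π), f' x ^ 2 := by
  have hfc : Continuous f := continuous_iff_continuousAt.2 fun x => (hf x).continuousAt
  obtain ⟨x₀, hx₀, h₀⟩ := exists_eq_mean hfc (c := 0) (by simpa using h0)
  obtain ⟨x₁, hx₁, h₁⟩ := exists_eq_mean (hfc.pow 2) hc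
  -- The primitive f³/3 - cf of (f² - c)f' vanishes where f = 0 and has square 4c³/9 where f² = c;
  -- its oscillation is at most ∫ |(f² - c)f'|.
  have hF (x : ℝ) : HasDerivAt (fun x => f x ^ 3 / 3 - c * f x) ((f x ^ 2 - c) * f' x) x := by
    refine ((((hf x).pow 3).div_const 3).sub ((hf x).const_mul c)).congr_deriv ?_
    push_cast
    ring
  have h := abs_sub_le_integral_abs hF (by fun_prop) hx₁ hx₀
  have hcs := sq_integral_abs_mul_le (f := fun x => f x ^ 2 - c) (by fun_prop) hf'
    Real.two_pi_pos.le
  refine le_trans ?_ hcs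
  refine le_trans (le_of_eq ?_) (pow_le_pow_left₀ (abs_nonneg _) h 2)
  have h₁' : f x₁ ^ 2 = c := h₁
  rw [sq_abs, h₀, ← h₁']
  ring

/-- A priori bound for periodic solutions of `w' = -2a(w + z) + 2c` of mean zero. -/
theorem exists_integral_sq_le (ρ : ℝ) : ∃ K : ℝ, 0 ≤ K ∧ ∀ a w z : ℝ → ℝ, ∀ c : ℝ,
    Continuous a → Continuous z →
    (∀ x, HasDerivAt w (-2 * (a x * (w x + z x)) + 2 * c) x) → w (2 * π) = w 0 →
    ∫ x in (0 : ℝ)..(2 * π), a x = 0 → ∫ x in (0 : ℝ)..(2 * π), w x = 0 →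
    ∫ x in (0 : ℝ)..(2 * π), a x ^ 2 ≤ ρ →
    ∫ x in (0 : ℝ)..(2 * π), w x ^ 2 ≤ K * ∫ x in (0 : ℝ)..(2 * π), z x ^ 2 := by
  have hpi := Real.two_pi_pos
  -- By Cauchy–Schwarz `m` bounds 2|∫₀ˣ a|, so the integrating factor lies between exp(-m) and
  -- exp(m); `D` is the resulting constant in sup |w| ≤ D ∫ |az|.
  set m : ℝ := 2 * √(ρ * (2 * π)) with hm
  set D : ℝ := 2 * exp m * (exp m * (exp m * exp m + 1)) with hD
  refine ⟨2 * π * (D ^ 2 * |ρ|), by positivity, fun a w z c ha hz hw hper ha0 hw0 haρ => ?_⟩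
  have hwc : Continuous w := continuous_iff_continuousAt.2 fun x => (hw x).continuousAt
  set A : ℝ → ℝ := fun x => ∫ t in (0 : ℝ)..x, a t with hAdef
  have hA (x : ℝ) : HasDerivAt A (a x) x :=
    integral_hasDerivAt_right (ha.intervalIntegrable _ _)
      ha.aestronglyMeasurable.stronglyMeasurableAtFilter ha.continuousAt
  have hA0 : A 0 = 0 := by simp [hAdef]
  have hA2 : A (2 * π) = 0 := ha0
  have hAc : Continuous A := continuous_iff_continuousAt.2 fun x => (hA x).continuousAt
  have hAb (x : ℝ) (hx : x ∈ Set.Icc 0 (2 * π)) : |2 * A x| ≤ m := by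
    have h1 := abs_sub_le_integral_abs hA ha hx ⟨le_rfl, hpi.le⟩
    have h2 := sq_integral_abs_mul_le ha (continuous_const (y := (1 : ℝ))) hpi.le
    simp only [mul_one, one_pow, integral_const, sub_zero, smul_eq_mul] at h2
    rw [hA0, sub_zero] at h1
    rw [abs_mul, abs_two, hm]
    gcongr
    refine h1.trans (Real.le_sqrt_of_sq_le (h2.trans ?_))
    gcongr
  set E : ℝ → ℝ := fun x => exp (2 * A x) with hEdef
  have hEc : Continuous E := by fun_prop
  have hEpos (x : ℝ) : 0 < E x := exp_pos _
  have hEle (x : ℝ) (hx : x ∈ Set.Icc 0 (2 * π)) : E x ≤ exp m :=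
    exp_le_exp.2 ((le_abs_self _).trans (hAb x hx))
  have hEge (x : ℝ) (hx : x ∈ Set.Icc 0 (2 * π)) : exp (-m) ≤ E x :=
    exp_le_exp.2 (neg_le_of_abs_le (hAb x hx))
  have hF (x : ℝ) : HasDerivAt (fun x => E x * w x) (2 * (E x * (c - a x * z x))) x := by
    have h1 : HasDerivAt E (E x * (2 * a x)) x := ((hA x).const_mul 2).exp
    refine (h1.mul (hw x)).congr_deriv ?_
    ring
  set I : ℝ := ∫ x in (0 : ℝ)..(2 * π), |a x * z x| with hI
  have hI0 : 0 ≤ I := integral_nonneg hpi.le fun x _ => abs_nonneg _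
  -- Since `a` has mean zero, `E` and hence E w take equal values at 0 and 2π. Integrating (E w)'
  -- over the period therefore determines `c`.
  have hcE : c * ∫ x in (0 : ℝ)..(2 * π), E x = ∫ x in (0 : ℝ)..(2 * π), E x * (a x * z x) := by
    have h := integral_eq_sub_of_hasDerivAt (a := 0) (b := 2 * π) (fun t _ => hF t)
      (Continuous.intervalIntegrable (by fun_prop) _ _)
    have h2 : E (2 * π) * w (2 * π) - E 0 * w 0 = 0 := by simp [hEdef, hA0, hA2, hper]
    rw [h2, integral_const_mul] at h
    have e : (fun x => E x * (c - a x * z x)) = fun x => c * E x - E x * (a x * z x) := by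
      ext x; ring
    rw [e, integral_sub, integral_const_mul] at h
    · linarith
    all_goals exact Continuous.intervalIntegrable (by fun_prop) _ _
  have hcb : 2 * π * |c| ≤ exp m * exp m * I := by
    have h1 : 2 * π * exp (-m) ≤ ∫ x in (0 : ℝ)..(2 * π), E x := by
      have h : ∫ _ in (0 : ℝ)..(2 * π), exp (-m) ≤ ∫ x in (0 : ℝ)..(2 * π), E x :=
        integral_mono_on hpi.le (continuous_const.intervalIntegrable _ _)
          (hEc.intervalIntegrable _ _) hEge
      simpa using h
    have h2 : |∫ x in (0 : ℝ)..(2 * π), E x * (a x * z x)| ≤ exp m * I := by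
      refine (abs_integral_le_integral_abs hpi.le).trans ?_
      rw [hI, ← integral_const_mul]
      refine integral_mono_on hpi.le (Continuous.intervalIntegrable (by fun_prop) _ _)
        (Continuous.intervalIntegrable (by fun_prop) _ _) fun x hx => ?_
      rw [abs_mul, abs_of_pos (hEpos x)]
      gcongr
      exact hEle x hx
    rw [← hcE, abs_mul, abs_of_nonneg (a := ∫ x in (0 : ℝ)..(2 * π), E x)
      (by linarith [mul_pos hpi (exp_pos (-m))])] at h2
    have h3 : |c| * (2 * π * exp (-m)) ≤ exp m * I :=
      (mul_le_mul_of_nonneg_left h1 (abs_nonneg c)).trans h2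
    have h4 : exp m * exp (-m) = 1 := by rw [← exp_add]; simp
    calc 2 * π * |c| = exp m * (|c| * (2 * π * exp (-m))) := by
          linear_combination (-(2 * π * |c|)) * h4
      _ ≤ exp m * (exp m * I) := by gcongr
      _ = _ := by ring
  -- A zero of `w` replaces an initial condition: E w is then bounded by its total variation.
  obtain ⟨x₀, hx₀, h₀⟩ := exists_eq_mean hwc (c := 0) (by simpa using hw0)
  have hvar : ∫ t in (0 : ℝ)..(2 * π), |2 * (E t * (c - a t * z t))| ≤
      2 * exp m * ((exp m * exp m + 1) * I) := by
    have h1 : ∫ t in (0 : ℝ)..(2 * π), |2 * (E t * (c - a t * z t))| ≤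
        ∫ t in (0 : ℝ)..(2 * π), 2 * exp m * (|c| + |a t * z t|) := by
      refine integral_mono_on hpi.le (Continuous.intervalIntegrable (by fun_prop) _ _)
        (Continuous.intervalIntegrable (by fun_prop) _ _) fun x hx => ?_
      rw [abs_mul, abs_mul, abs_two, abs_of_pos (hEpos x), mul_assoc]
      gcongr
      · exact hEle x hx
      · exact abs_sub _ _
    refine h1.trans ?_
    rw [integral_const_mul, integral_add (continuous_const.intervalIntegrable _ _)
      (Continuous.intervalIntegrable (by fun_prop) _ _)]
    simp only [integral_const, sub_zero, smul_eq_mul]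
    gcongr
    rw [add_mul, one_mul]
    gcongr
  have hwb (x : ℝ) (hx : x ∈ Set.Icc 0 (2 * π)) : |w x| ≤ D * I := by
    have h1 := (abs_sub_le_integral_abs hF (by fun_prop) hx hx₀).trans hvar
    rw [h₀, mul_zero, sub_zero, abs_mul, abs_of_pos (hEpos x)] at h1
    have h4 : exp m * exp (-m) = 1 := by rw [← exp_add]; simp
    have h5 : exp (-m) * |w x| ≤ E x * |w x| := by gcongr; exact hEge x hx
    calc |w x| = exp m * (exp (-m) * |w x|) := by linear_combination (-|w x|) * h4
      _ ≤ exp m * (2 * exp m * ((exp m * exp m + 1) * I)) := by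
          exact mul_le_mul_of_nonneg_left (h5.trans h1) (exp_pos m).le
      _ = D * I := by rw [hD]; ring
  have hIsq : I ^ 2 ≤ |ρ| * ∫ x in (0 : ℝ)..(2 * π), z x ^ 2 := by
    refine (sq_integral_abs_mul_le ha hz hpi.le).trans ?_
    gcongr
    · exact integral_nonneg hpi.le fun x _ => sq_nonneg _
    · exact haρ.trans (le_abs_self _)
  calc ∫ x in (0 : ℝ)..(2 * π), w x ^ 2 ≤ ∫ x in (0 : ℝ)..(2 * π), (D * I) ^ 2 := by
        refine integral_mono_on hpi.le (Continuous.intervalIntegrable (by fun_prop) _ _)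
          (Continuous.intervalIntegrable (by fun_prop) _ _) fun x hx => ?_
        rw [← sq_abs (w x)]
        exact pow_le_pow_left₀ (abs_nonneg _) (hwb x hx) 2
    _ = 2 * π * D ^ 2 * I ^ 2 := by simp; ring
    _ ≤ 2 * π * D ^ 2 * (|ρ| * ∫ x in (0 : ℝ)..(2 * π), z x ^ 2) := by gcongr
    _ = _ := by ring

end PeriodicODE

/-! ### From Fourier coefficients to functions, for trigonometric polynomials. -/

section TrigonometricPolynomials

open Real intervalIntegral

/-- The function with Fourier coefficients `f`. -/
noncomputable def trig (f : Coeffs) (x : ℝ) : ℂ := ∑' k : ℤ, f k * Complex.exp (Complex.I * k * x)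

/-- The antiderivative of mean zero: `(∂⁻¹ f)^(k) = f̂(k) / (i k)` for `k ≠ 0`. -/
noncomputable def antideriv (f : Coeffs) : Coeffs := fun k => (Complex.I * k)⁻¹ * f k

/-- The coefficients of a real-valued function. -/
def IsRealValued (f : Coeffs) : Prop := ∀ k, f (-k) = conj (f k)

variable {f g : Coeffs}

theorem IsRealValued.mul (hf : IsRealValued f) (hg : IsRealValued g) :
    IsRealValued (TorusSobolev.mul f g) := by
  intro k
  rw [TorusSobolev.mul, TorusSobolev.mul, Complex.conj_tsum, ← (Equiv.neg ℤ).tsum_eq]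
  refine tsum_congr fun j => ?_
  rw [map_mul, ← hf, ← hg]
  simp only [Equiv.neg_apply]
  congr 2
  ring

theorem IsRealValued.deriv (hf : IsRealValued f) : IsRealValued (TorusSobolev.deriv f) := by
  intro k
  simp [TorusSobolev.deriv, hf k]

theorem IsRealValued.antideriv (hf : IsRealValued f) :
    IsRealValued (TorusSobolev.antideriv f) := by
  intro k
  simp [TorusSobolev.antideriv, hf k]

theorem support_mul_finite (hf : f.support.Finite) (hg : g.support.Finite) :
    (mul f g).support.Finite := by
  refine (hf.image2 (· + ·) hg).subset fun k hk => ?_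
  by_contra hk'
  refine hk ?_
  rw [mul, ← tsum_zero (α := ℂ) (β := ℤ)]
  refine tsum_congr fun j => ?_
  by_contra hj
  obtain ⟨h1, h2⟩ := mul_ne_zero_iff.1 hj
  exact hk' ⟨j, h1, k - j, h2, by simp⟩

theorem trig_eq_sum (hf : f.support.Finite) (x : ℝ) :
    trig f x = ∑ k ∈ hf.toFinset, f k * Complex.exp (Complex.I * k * x) :=
  tsum_eq_sum fun k hk => by
    have : f k = 0 := by simpa using hk
    simp [this]

theorem trig_mul (hf : f.support.Finite) (hg : g.support.Finite) (x : ℝ) :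
    trig (mul f g) x = trig f x * trig g x := by
  have hF : Summable (Function.uncurry fun k j : ℤ =>
      f j * g (k - j) * Complex.exp (Complex.I * k * x)) := by
    refine summable_of_hasFiniteSupport (((hf.prod hg).image
      fun p : ℤ × ℤ => (p.1 + p.2, p.1)).subset ?_)
    rintro ⟨k, j⟩ h
    have h1 : f j ≠ 0 := fun h' => h (by simp [Function.uncurry, h'])
    have h2 : g (k - j) ≠ 0 := fun h' => h (by simp [Function.uncurry, h'])
    exact ⟨(j, k - j), ⟨h1, h2⟩, by simp⟩
  calc trig (mul f g) x
      = ∑' k : ℤ, ∑' j : ℤ, f j * g (k - j) * Complex.exp (Complex.I * k * x) := by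
        simp only [trig, mul, tsum_mul_right]
    _ = ∑' j : ℤ, ∑' k : ℤ, f j * g (k - j) * Complex.exp (Complex.I * k * x) := hF.tsum_comm.symm
    _ = ∑' j : ℤ, f j * Complex.exp (Complex.I * j * x) * trig g x := by
        refine tsum_congr fun j => ?_
        rw [trig, ← tsum_mul_left, ← (Equiv.addRight j).tsum_eq]
        refine tsum_congr fun k => ?_
        simp only [Equiv.coe_addRight, add_sub_cancel_right, Int.cast_add]
        rw [mul_add, add_mul, Complex.exp_add]
        ring
    _ = trig f x * trig g x := by rw [tsum_mul_right, ← trig]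

theorem support_deriv_finite (hf : f.support.Finite) : (deriv f).support.Finite :=
  hf.subset fun k hk h => hk (by simp [deriv, h])

theorem support_antideriv_finite (hf : f.support.Finite) : (antideriv f).support.Finite :=
  hf.subset fun k hk h => hk (by simp [antideriv, h])

theorem hasDerivAt_trig (hf : f.support.Finite) (x : ℝ) :
    HasDerivAt (trig f) (trig (deriv f) x) x := by
  have h1 : trig f = fun x : ℝ => ∑ k ∈ hf.toFinset, f k * Complex.exp (Complex.I * k * x) :=
    funext (trig_eq_sum hf)
  have h2 : trig (deriv f) x =
      ∑ k ∈ hf.toFinset, deriv f k * Complex.exp (Complex.I * k * x) :=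
    tsum_eq_sum fun k hk => by
      have : f k = 0 := by simpa using hk
      simp [deriv, this]
  rw [h1, h2]
  refine HasDerivAt.fun_sum fun k _ => ?_
  have h3 : HasDerivAt (fun y : ℝ => Complex.I * k * (y : ℂ)) (Complex.I * k * 1) x :=
    (Complex.ofRealCLM.hasDerivAt).const_mul _
  refine (h3.cexp.const_mul (f k)).congr_deriv ?_
  rw [deriv]
  ring

theorem continuous_trig (hf : f.support.Finite) : Continuous (trig f) :=
  continuous_iff_continuousAt.2 fun x => (hasDerivAt_trig hf x).continuousAt

theorem integral_trig (hf : f.support.Finite) :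
    ∫ x in (0 : ℝ)..(2 * π), trig f x = 2 * π * f 0 := by
  have hexp (k : ℤ) : ∫ x in (0 : ℝ)..(2 * π), Complex.exp (Complex.I * k * x) =
      if k = 0 then 2 * π else 0 := by
    split_ifs with hk
    · simp [hk]
    · rw [integral_exp_mul_complex (by simp [hk])]
      have : Complex.I * k * ((2 * π : ℝ) : ℂ) = k * (2 * π * Complex.I) := by push_cast; ring
      rw [this, Complex.exp_int_mul_two_pi_mul_I]
      simp
  simp_rw [trig_eq_sum hf]
  rw [integral_finsetSum fun k _ => Continuous.intervalIntegrable (by fun_prop) _ _]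
  simp_rw [integral_const_mul, hexp]
  rw [Finset.sum_eq_single 0]
  · simp; ring
  · intro k _ hk; simp [hk]
  · intro h
    have h0 : f 0 = 0 := by simpa using h
    simp [h0]

theorem trig_two_pi (f : Coeffs) : trig f (2 * π : ℝ) = trig f 0 := by
  refine tsum_congr fun k => ?_
  have : Complex.I * k * ((2 * π : ℝ) : ℂ) = k * (2 * π * Complex.I) := by push_cast; ring
  rw [this, Complex.exp_int_mul_two_pi_mul_I]
  simp

/-- The real part of the function with Fourier coefficients `f`. -/
noncomputable def rtrig (f : Coeffs) (x : ℝ) : ℝ := (trig f x).re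

theorem ofReal_rtrig (hf : IsRealValued f) (x : ℝ) : (rtrig f x : ℂ) = trig f x := by
  refine Complex.conj_eq_iff_re.1 ?_
  rw [trig, Complex.conj_tsum, ← (Equiv.neg ℤ).tsum_eq]
  refine tsum_congr fun k => ?_
  rw [map_mul, ← hf, ← Complex.exp_conj]
  simp

theorem rtrig_mul (hf : f.support.Finite) (hg : g.support.Finite) (hfr : IsRealValued f)
    (hgr : IsRealValued g) (x : ℝ) : rtrig (mul f g) x = rtrig f x * rtrig g x := by
  apply Complex.ofReal_injective
  push_cast
  rw [ofReal_rtrig hfr, ofReal_rtrig hgr, ofReal_rtrig (hfr.mul hgr), trig_mul hf hg]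

theorem hasDerivAt_rtrig (hf : f.support.Finite) (x : ℝ) :
    HasDerivAt (rtrig f) (rtrig (deriv f) x) x :=
  Complex.reCLM.hasFDerivAt.comp_hasDerivAt x (hasDerivAt_trig hf x)

theorem continuous_rtrig (hf : f.support.Finite) : Continuous (rtrig f) :=
  Complex.continuous_re.comp (continuous_trig hf)

theorem integral_rtrig (hf : f.support.Finite) :
    ∫ x in (0 : ℝ)..(2 * π), rtrig f x = 2 * π * (f 0).re := by
  have h := Complex.reCLM.intervalIntegral_comp_comm
    ((continuous_trig hf).intervalIntegrable (μ := MeasureTheory.volume) 0 (2 * π))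
  rw [integral_trig hf] at h
  simpa [rtrig] using h

theorem mul_self_zero (hfr : IsRealValued f) : mul f f 0 = ((∑' k, ‖f k‖ ^ 2 : ℝ) : ℂ) := by
  rw [mul, Complex.ofReal_tsum]
  refine tsum_congr fun k => ?_
  rw [zero_sub, hfr, Complex.mul_conj, Complex.normSq_eq_norm_sq]

theorem integral_rtrig_sq (hf : f.support.Finite) (hfr : IsRealValued f) :
    ∫ x in (0 : ℝ)..(2 * π), rtrig f x ^ 2 = 2 * π * ∑' k, ‖f k‖ ^ 2 := by
  have h := integral_rtrig (support_mul_finite hf hf)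
  rw [mul_self_zero hfr, Complex.ofReal_re] at h
  rw [← h]
  simp_rw [rtrig_mul hf hf hfr hfr, sq]

/-- `∫ w² w_x = 0`. -/
theorem mul_mul_deriv_zero (hf : f.support.Finite) (hfr : IsRealValued f) :
    (mul (mul f f) (deriv f) 0).re = 0 := by
  have hff := support_mul_finite hf hf
  have hd := support_deriv_finite hf
  have h := integral_rtrig (support_mul_finite hff hd)
  have h2 : ∫ x in (0 : ℝ)..(2 * π), rtrig (mul (mul f f) (deriv f)) x = 0 := by
    have hF (x : ℝ) : HasDerivAt (fun x => rtrig f x ^ 3 / 3)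
        (rtrig (mul (mul f f) (deriv f)) x) x := by
      refine (((hasDerivAt_rtrig hf x).pow 3).div_const 3).congr_deriv ?_
      rw [rtrig_mul hff hd (hfr.mul hfr) hfr.deriv, rtrig_mul hf hf hfr hfr]
      push_cast
      ring
    rw [integral_eq_sub_of_hasDerivAt (fun x _ => hF x)
      ((continuous_rtrig (support_mul_finite hff hd)).intervalIntegrable _ _)]
    simp [rtrig, ← trig_two_pi f]
  rw [h2] at h
  have := Real.two_pi_pos
  rcases mul_eq_zero.1 h.symm with h | h
  · linarith
  · exact h

/-- The coefficients of `f - P₀ f`. -/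
noncomputable def removeMean (f : Coeffs) : Coeffs := f - mean f

theorem removeMean_apply (f : Coeffs) (k : ℤ) : removeMean f k = if k = 0 then 0 else f k := by
  simp only [removeMean, mean, Pi.sub_apply]
  split_ifs <;> simp

theorem IsRealValued.removeMean (hf : IsRealValued f) :
    IsRealValued (TorusSobolev.removeMean f) := by
  intro k
  simp only [removeMean_apply, neg_eq_zero, hf k]
  split_ifs <;> simp

theorem support_removeMean_finite (hf : f.support.Finite) : (removeMean f).support.Finite :=
  hf.subset fun k hk h => hk (by rw [removeMean_apply, h, ite_self])

theorem rtrig_removeMean (hf : f.support.Finite) (x : ℝ) :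
    rtrig (removeMean f) x = rtrig f x - (f 0).re := by
  have h : trig (removeMean f) x = trig f x - f 0 := by
    have h1 : Summable fun k : ℤ => f k * Complex.exp (Complex.I * k * x) :=
      summable_of_hasFiniteSupport (hf.subset fun k hk h => hk (by simp [h]))
    rw [trig, trig, h1.tsum_eq_add_tsum_ite 0]
    simp only [removeMean_apply, ite_mul, zero_mul, Int.cast_zero, mul_zero, Complex.exp_zero]
    ring
  rw [rtrig, h, Complex.sub_re, rtrig]

/-- The square of a function of mean zero is not close to a nonzero constant, unless the derivative
of the function is large. -/
theorem tsum_sq_pow_three_le (hf : f.support.Finite) (hfr : IsRealValued f) (h0 : f 0 = 0) :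
    (∑' k, ‖f k‖ ^ 2) ^ 3 ≤ 9 / 4 * (2 * π) ^ 2 *
      ((∑' k, ‖removeMean (mul f f) k‖ ^ 2) * ∑' k, ‖deriv f k‖ ^ 2) := by
  have hff := support_mul_finite hf hf
  have h := mean_sq_pow_three_le (hasDerivAt_rtrig hf) (continuous_rtrig (support_deriv_finite hf))
    (by rw [integral_rtrig hf, h0]; simp) (integral_rtrig_sq hf hfr)
  have e (x : ℝ) : rtrig f x ^ 2 - ∑' k, ‖f k‖ ^ 2 = rtrig (removeMean (mul f f)) x := by
    rw [rtrig_removeMean hff, rtrig_mul hf hf hfr hfr, mul_self_zero hfr, Complex.ofReal_re, sq]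
  simp_rw [e] at h
  rw [integral_rtrig_sq (support_deriv_finite hf) hfr.deriv,
    integral_rtrig_sq (support_removeMean_finite hff) (hfr.mul hfr).removeMean] at h
  linarith

theorem deriv_antideriv (f : Coeffs) : deriv (antideriv f) = removeMean f := by
  ext k
  rw [removeMean_apply, deriv, antideriv]
  split_ifs with hk
  · simp [hk]
  · rw [← mul_assoc, mul_inv_cancel₀ (by simp [hk]), one_mul]

theorem rtrig_add (hf : f.support.Finite) (hg : g.support.Finite) (x : ℝ) :
    rtrig (f + g) x = rtrig f x + rtrig g x := by
  have h1 : Summable fun k : ℤ => f k * Complex.exp (Complex.I * k * x) :=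
    summable_of_hasFiniteSupport (hf.subset fun k hk h => hk (by simp [h]))
  have h2 : Summable fun k : ℤ => g k * Complex.exp (Complex.I * k * x) :=
    summable_of_hasFiniteSupport (hg.subset fun k hk h => hk (by simp [h]))
  rw [rtrig, rtrig, rtrig, ← Complex.add_re]
  congr 1
  simp only [trig, Pi.add_apply, add_mul]
  exact h1.tsum_add h2

theorem rtrig_smul (c : ℝ) (f : Coeffs) (x : ℝ) : rtrig (c • f) x = c * rtrig f x := by
  rw [rtrig, rtrig, trig, trig, ← Complex.re_ofReal_mul, ← tsum_mul_left]
  congr 1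
  refine tsum_congr fun k => ?_
  simp [mul_assoc]

theorem deriv_smul (c : ℝ) (f : Coeffs) : deriv (c • f) = c • deriv f := by
  ext k
  simp [deriv]
  ring

/-- The linearized equation `v + 2 ∂⁻¹(a v) = z`, for trigonometric polynomials. -/
theorem exists_tsum_sq_antideriv_mul_le (ρ : ℝ) : ∃ K : ℝ, 0 ≤ K ∧ ∀ a v : Coeffs,
    a.support.Finite → v.support.Finite → IsRealValued a → IsRealValued v → a 0 = 0 →
    ∑' k, ‖a k‖ ^ 2 ≤ ρ →
    ∑' k, ‖((-2 : ℝ) • antideriv (mul a v)) k‖ ^ 2 ≤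
      K * ∑' k, ‖(v + (2 : ℝ) • antideriv (mul a v)) k‖ ^ 2 := by
  have hpi := Real.two_pi_pos
  obtain ⟨K, hK0, hK⟩ := exists_integral_sq_le (2 * π * ρ)
  refine ⟨K, hK0, fun a v ha hv har hvr ha0 haρ => ?_⟩
  have hav := support_mul_finite ha hv
  have hsm (c : ℝ) : (c • antideriv (mul a v)).support.Finite :=
    (support_antideriv_finite hav).subset (Function.support_const_smul_subset _ _)
  have hsmr (c : ℝ) : IsRealValued (c • antideriv (mul a v)) := by
    intro k
    simp [(har.mul hvr).antideriv k]
  have hz : (v + (2 : ℝ) • antideriv (mul a v)).support.Finite :=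
    (hv.union (hsm 2)).subset (Function.support_add _ _)
  have hzr : IsRealValued (v + (2 : ℝ) • antideriv (mul a v)) := by
    intro k
    rw [Pi.add_apply, Pi.add_apply, hvr, hsmr, map_add]
  -- With z = v + 2∂⁻¹(av) and w = -2∂⁻¹(av) one has v = w + z and w' = -2a(w + z) + 2c, where c is
  -- the mean of av.
  have h := hK (rtrig a) (rtrig ((-2 : ℝ) • antideriv (mul a v)))
    (rtrig (v + (2 : ℝ) • antideriv (mul a v))) (mul a v 0).re (continuous_rtrig ha)
    (continuous_rtrig hz) ?_ ?_ ?_ ?_ ?_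
  · rw [integral_rtrig_sq (hsm _) (hsmr _), integral_rtrig_sq hz hzr] at h
    refine le_of_mul_le_mul_left ?_ hpi
    linarith
  · intro x
    refine (hasDerivAt_rtrig (hsm (-2)) x).congr_deriv ?_
    rw [deriv_smul, rtrig_smul, deriv_antideriv, rtrig_removeMean hav, rtrig_mul ha hv har hvr,
      rtrig_add hv (hsm 2), rtrig_smul, rtrig_smul]
    ring
  · rw [rtrig, trig_two_pi, rtrig]
  · rw [integral_rtrig ha, ha0]; simp
  · rw [integral_rtrig (hsm _)]; simp [antideriv]
  · rw [integral_rtrig_sq ha har]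
    gcongr

end TrigonometricPolynomials

/-! ### Sobolev energies and product estimates by convolution. -/

section ProductEstimates

/-- The square `∑ (1 + k²)^s |û(k)|²` of the Sobolev norm, up to the factor `2π`. -/
noncomputable def energy (s : ℝ) (u : Coeffs) : ℝ := ∑' k : ℤ, (1 + (k : ℝ) ^ 2) ^ s * ‖u k‖ ^ 2

/-- `∑ (1 + k²)^s |û(k)|²` converges. -/
def FiniteEnergy (s : ℝ) (u : Coeffs) : Prop :=
  Summable fun k : ℤ => (1 + (k : ℝ) ^ 2) ^ s * ‖u k‖ ^ 2

variable {u v w : Coeffs} {s t : ℝ}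

theorem one_le_one_add_sq (k : ℤ) : (1 : ℝ) ≤ 1 + (k : ℝ) ^ 2 := by
  linarith [sq_nonneg (k : ℝ)]

theorem one_add_sq_pos (k : ℤ) : (0 : ℝ) < 1 + (k : ℝ) ^ 2 := by
  linarith [sq_nonneg (k : ℝ)]

theorem energy_term_nonneg (s : ℝ) (u : Coeffs) (k : ℤ) :
    0 ≤ (1 + (k : ℝ) ^ 2) ^ s * ‖u k‖ ^ 2 := by
  have := one_add_sq_pos k
  positivity

theorem energy_nonneg (s : ℝ) (u : Coeffs) : 0 ≤ energy s u := tsum_nonneg (energy_term_nonneg s u)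

theorem energy_term_mono (hst : s ≤ t) (u : Coeffs) (k : ℤ) :
    (1 + (k : ℝ) ^ 2) ^ s * ‖u k‖ ^ 2 ≤ (1 + (k : ℝ) ^ 2) ^ t * ‖u k‖ ^ 2 := by
  gcongr
  exact one_le_one_add_sq k

theorem FiniteEnergy.mono (hst : s ≤ t) (h : FiniteEnergy t u) : FiniteEnergy s u :=
  Summable.of_nonneg_of_le (energy_term_nonneg s u) (energy_term_mono hst u) h

theorem energy_mono (hst : s ≤ t) (h : FiniteEnergy t u) : energy s u ≤ energy t u :=
  (h.mono hst).tsum_le_tsum (energy_term_mono hst u) h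

theorem energy_zero (u : Coeffs) : energy 0 u = ∑' k, ‖u k‖ ^ 2 := by simp [energy]

theorem finiteEnergy_zero_iff : FiniteEnergy 0 u ↔ Summable fun k => ‖u k‖ ^ 2 := by
  simp [FiniteEnergy]

theorem finiteEnergy_of_support_finite (s : ℝ) (hu : u.support.Finite) : FiniteEnergy s u :=
  summable_of_hasFiniteSupport (hu.subset fun k hk h => hk (by simp [h]))

theorem summable_mul_and_sq_tsum_mul_le {ι : Type*} {f g : ι → ℝ} (hf : ∀ i, 0 ≤ f i)
    (hg : ∀ i, 0 ≤ g i) (hf2 : Summable fun i => f i ^ 2) (hg2 : Summable fun i => g i ^ 2) :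
    (Summable fun i => f i * g i) ∧
      (∑' i, f i * g i) ^ 2 ≤ (∑' i, f i ^ 2) * ∑' i, g i ^ 2 := by
  have hs : Summable fun i => f i * g i := by
    refine Summable.of_nonneg_of_le (fun i => mul_nonneg (hf i) (hg i)) (fun i => ?_)
      (hf2.add hg2)
    nlinarith [sq_nonneg (f i - g i), sq_nonneg (f i), sq_nonneg (g i)]
  refine ⟨hs, ?_⟩
  refine le_of_tendsto (hs.hasSum.pow 2) (Filter.Eventually.of_forall fun S => ?_)
  refine (Finset.sum_mul_sq_le_sq_mul_sq S f g).trans ?_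
  gcongr
  · exact hf2.sum_le_tsum S fun i _ => sq_nonneg _
  · exact hg2.sum_le_tsum S fun i _ => sq_nonneg _

theorem summable_comp_sub {f : ℤ → ℝ} (hf : Summable f) (k : ℤ) : Summable fun j => f (k - j) :=
  (Equiv.subLeft k).summable_iff.2 hf

theorem tsum_comp_sub (f : ℤ → ℝ) (k : ℤ) : ∑' j, f (k - j) = ∑' j, f j :=
  (Equiv.subLeft k).tsum_eq f

theorem summable_convolution {f g : ℤ → ℝ} (hf : ∀ i, 0 ≤ f i)
    (hg : ∀ i, 0 ≤ g i) (hf2 : Summable fun i => f i ^ 2) (hg2 : Summable fun i => g i ^ 2) (k : ℤ) :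
    (Summable fun j => f j * g (k - j)) ∧
      (∑' j, f j * g (k - j)) ^ 2 ≤ (∑' j, f j ^ 2) * ∑' j, g j ^ 2 := by
  have h := summable_mul_and_sq_tsum_mul_le hf (fun j => hg (k - j)) hf2
    (summable_comp_sub hg2 k)
  rwa [tsum_comp_sub (fun j => g j ^ 2)] at h

theorem summable_mul_term (hu : FiniteEnergy 0 u) (hv : FiniteEnergy 0 v) (k : ℤ) :
    Summable fun j => u j * v (k - j) := by
  refine Summable.of_norm ?_
  simp only [norm_mul]
  exact (summable_convolution (fun _ => norm_nonneg _) (fun _ => norm_nonneg _)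
    (finiteEnergy_zero_iff.1 hu) (finiteEnergy_zero_iff.1 hv) k).1

theorem norm_mul_le_tsum (hu : FiniteEnergy 0 u) (hv : FiniteEnergy 0 v) (k : ℤ) :
    ‖mul u v k‖ ≤ ∑' j, ‖u j‖ * ‖v (k - j)‖ := by
  have h := (summable_convolution (fun _ => norm_nonneg _) (fun _ => norm_nonneg _)
    (finiteEnergy_zero_iff.1 hu) (finiteEnergy_zero_iff.1 hv) k).1
  simp only [← norm_mul] at h ⊢
  exact norm_tsum_le_tsum_norm h

theorem norm_mul_sq_le (hu : FiniteEnergy 0 u) (hv : FiniteEnergy 0 v) (k : ℤ) :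
    ‖mul u v k‖ ^ 2 ≤ energy 0 u * energy 0 v := by
  refine (pow_le_pow_left₀ (norm_nonneg _) (norm_mul_le_tsum hu hv k) 2).trans ?_
  rw [energy_zero, energy_zero]
  exact (summable_convolution (fun _ => norm_nonneg _) (fun _ => norm_nonneg _)
    (finiteEnergy_zero_iff.1 hu) (finiteEnergy_zero_iff.1 hv) k).2

theorem mul_comm_coeffs (u v : Coeffs) : mul u v = mul v u := by
  ext k
  rw [mul, mul, ← (Equiv.subLeft k).tsum_eq]
  refine tsum_congr fun j => ?_
  simp [mul_comm]

theorem mul_add_coeffs (hu : FiniteEnergy 0 u) (hv : FiniteEnergy 0 v) (hw : FiniteEnergy 0 w) :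
    mul u (v + w) = mul u v + mul u w := by
  ext k
  simp only [mul, Pi.add_apply, mul_add]
  exact (summable_mul_term hu hv k).tsum_add (summable_mul_term hu hw k)

theorem mul_smul_coeffs (c : ℝ) (u v : Coeffs) : mul u (c • v) = c • mul u v := by
  ext k
  simp only [mul, Pi.smul_apply, Complex.real_smul, ← tsum_mul_left]
  refine tsum_congr fun j => ?_
  ring

/-- The square root of the weight `(1 + k²)^s`. -/
noncomputable def weight (s : ℝ) (k : ℤ) : ℝ := (1 + (k : ℝ) ^ 2) ^ (s / 2)

theorem weight_pos (s : ℝ) (k : ℤ) : 0 < weight s k := Real.rpow_pos_of_pos (one_add_sq_pos k) _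

theorem weight_sq (s : ℝ) (k : ℤ) : weight s k ^ 2 = (1 + (k : ℝ) ^ 2) ^ s := by
  rw [weight, ← Real.rpow_natCast, ← Real.rpow_mul (one_add_sq_pos k).le]
  norm_num

theorem weight_neg (s : ℝ) (k : ℤ) : weight s (-k) = weight s k := by simp [weight]

theorem weight_mul (s t : ℝ) (k : ℤ) : weight s k * weight t k = weight (s + t) k := by
  rw [weight, weight, weight, ← Real.rpow_add (one_add_sq_pos k)]
  congr 1
  ring

theorem weight_zero (k : ℤ) : weight 0 k = 1 := by simp [weight]

/-- One of j and k - j is at least |k|/2 in modulus, so in a convolution the weight can be moved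
onto a single factor. -/
theorem weight_le (hs : 0 ≤ s) (k j : ℤ) :
    weight s k ≤ 4 ^ (s / 2) * (weight s j + weight s (k - j)) := by
  have h1 : 1 + (k : ℝ) ^ 2 ≤ 4 * max (1 + (j : ℝ) ^ 2) (1 + ((k - j : ℤ) : ℝ) ^ 2) := by
    have h := le_max_left (1 + (j : ℝ) ^ 2) (1 + ((k - j : ℤ) : ℝ) ^ 2)
    have h' := le_max_right (1 + (j : ℝ) ^ 2) (1 + ((k - j : ℤ) : ℝ) ^ 2)
    generalize max (1 + (j : ℝ) ^ 2) (1 + ((k - j : ℤ) : ℝ) ^ 2) = m at h h' ⊢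
    push_cast at h'
    nlinarith [sq_nonneg ((k : ℝ) - 2 * j)]
  have h2 : weight s k ≤
      4 ^ (s / 2) * (max (1 + (j : ℝ) ^ 2) (1 + ((k - j : ℤ) : ℝ) ^ 2)) ^ (s / 2) := by
    rw [← Real.mul_rpow (by norm_num) (le_max_of_le_left (one_add_sq_pos j).le)]
    exact Real.rpow_le_rpow (one_add_sq_pos k).le h1 (by linarith)
  refine h2.trans ?_
  gcongr
  rcases max_choice (1 + (j : ℝ) ^ 2) (1 + ((k - j : ℤ) : ℝ) ^ 2) with h | h <;> rw [h]
  · exact le_add_of_nonneg_right (weight_pos s (k - j)).le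
  · exact le_add_of_nonneg_left (weight_pos s j).le

theorem weight_mul_norm_sq (s : ℝ) (u : Coeffs) (k : ℤ) :
    (weight s k * ‖u k‖) ^ 2 = (1 + (k : ℝ) ^ 2) ^ s * ‖u k‖ ^ 2 := by
  rw [mul_pow, weight_sq]

/-- The tame product estimate. -/
theorem weight_mul_norm_mul_sq_le (hs : 0 ≤ s) (hu : FiniteEnergy s u) (hv : FiniteEnergy s v)
    (k : ℤ) : (1 + (k : ℝ) ^ 2) ^ s * ‖mul u v k‖ ^ 2 ≤
      2 * 4 ^ s * (energy s u * energy 0 v + energy 0 u * energy s v) := by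
  have hu0 := hu.mono hs
  have hv0 := hv.mono hs
  have hu' : Summable fun j => (weight s j * ‖u j‖) ^ 2 := by
    simpa only [weight_mul_norm_sq] using (show Summable _ from hu)
  have hv' : Summable fun j => (weight s j * ‖v j‖) ^ 2 := by
    simpa only [weight_mul_norm_sq] using (show Summable _ from hv)
  obtain ⟨s1, h1⟩ := summable_convolution (fun j => by have := weight_pos s j; positivity)
    (fun _ => norm_nonneg _) hu' (finiteEnergy_zero_iff.1 hv0) k
  obtain ⟨s2, h2⟩ := summable_convolution (fun _ => norm_nonneg _)
    (fun j => by have := weight_pos s j; positivity) (finiteEnergy_zero_iff.1 hu0) hv' k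
  obtain ⟨s3, -⟩ := summable_convolution (fun _ => norm_nonneg _)
    (fun _ => norm_nonneg _) (finiteEnergy_zero_iff.1 hu0) (finiteEnergy_zero_iff.1 hv0) k
  simp only [weight_mul_norm_sq] at h1 h2
  have h4 : ((4 : ℝ) ^ (s / 2)) ^ 2 = 4 ^ s := by
    rw [← Real.rpow_natCast, ← Real.rpow_mul (by norm_num)]
    norm_num
  have h3 : weight s k * ‖mul u v k‖ ≤ 4 ^ (s / 2) *
      ((∑' j, weight s j * ‖u j‖ * ‖v (k - j)‖) +
        ∑' j, ‖u j‖ * (weight s (k - j) * ‖v (k - j)‖)) := by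
    calc weight s k * ‖mul u v k‖ ≤ weight s k * ∑' j, ‖u j‖ * ‖v (k - j)‖ :=
          mul_le_mul_of_nonneg_left (norm_mul_le_tsum hu0 hv0 k) (weight_pos s k).le
      _ = ∑' j, weight s k * (‖u j‖ * ‖v (k - j)‖) := by rw [tsum_mul_left]
      _ ≤ ∑' j, 4 ^ (s / 2) * (weight s j * ‖u j‖ * ‖v (k - j)‖ +
            ‖u j‖ * (weight s (k - j) * ‖v (k - j)‖)) := by
          refine (s3.mul_left _).tsum_le_tsum (fun j => ?_) ((s1.add s2).mul_left _)
          refine (mul_le_mul_of_nonneg_right (weight_le hs k j) (by positivity)).trans (le_of_eq ?_)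
          ring
      _ = _ := by rw [tsum_mul_left, s1.tsum_add s2]
  rw [← weight_mul_norm_sq]
  refine (pow_le_pow_left₀ (by have := weight_pos s k; positivity) h3 2).trans ?_
  rw [mul_pow, h4]
  rw [← energy_zero] at h1 h2
  change _ ≤ energy s u * energy 0 v at h1
  change _ ≤ energy 0 u * energy s v at h2
  have h5 := add_sq_le (a := ∑' j, weight s j * ‖u j‖ * ‖v (k - j)‖)
    (b := ∑' j, ‖u j‖ * (weight s (k - j) * ‖v (k - j)‖))
  have h6 : (0 : ℝ) ≤ 4 ^ s := by positivity
  nlinarith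

theorem summable_inv_one_add_sq : Summable fun k : ℤ => (1 + (k : ℝ) ^ 2)⁻¹ := by
  refine Summable.of_norm_bounded_eventually (g := fun k : ℤ => 1 / (k : ℝ) ^ 2)
    (Real.summable_one_div_int_pow.2 one_lt_two) ?_
  filter_upwards [(Set.finite_singleton (0 : ℤ)).compl_mem_cofinite] with k hk
  have hk0 : (k : ℝ) ≠ 0 := by simpa using hk
  have : 0 < (k : ℝ) ^ 2 := by positivity
  rw [Real.norm_of_nonneg (by positivity), one_div]
  gcongr
  linarith

/-- The product of two functions in `H^{1/2}` is square integrable. -/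
theorem sum_norm_mul_sq_le (hu : FiniteEnergy (1 / 2) u) (hv : FiniteEnergy (1 / 2) v)
    (S : Finset ℤ) : ∑ k ∈ S, ‖mul u v k‖ ^ 2 ≤
      (∑' k : ℤ, (1 + (k : ℝ) ^ 2)⁻¹) * (energy (1 / 2) u * energy (1 / 2) v) := by
  have hu0 := hu.mono (s := 0) (by norm_num)
  have hv0 := hv.mono (s := 0) (by norm_num)
  set D : ℝ := ∑' k : ℤ, (1 + (k : ℝ) ^ 2)⁻¹
  have hD0 : 0 ≤ D := tsum_nonneg fun k => by have := one_add_sq_pos k; positivity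
  let p : ℤ → ℝ := fun j => (1 + (j : ℝ) ^ 2) ^ (1 / 2 : ℝ) * ‖u j‖ ^ 2
  let r : ℤ → ℝ := fun j => (1 + (j : ℝ) ^ 2) ^ (1 / 2 : ℝ) * ‖v j‖ ^ 2
  have hp0 : ∀ j, 0 ≤ p j := energy_term_nonneg _ _
  have hr0 : ∀ j, 0 ≤ r j := energy_term_nonneg _ _
  have hpr (k : ℤ) : Summable fun j => p j * r (k - j) := by
    refine Summable.of_nonneg_of_le (fun j => mul_nonneg (hp0 j) (hr0 _)) (fun j => ?_)
      (Summable.mul_right (∑' j, r j) (show Summable p from hu))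
    exact mul_le_mul_of_nonneg_left (Summable.le_tsum hv (k - j) fun i _ => hr0 i) (hp0 j)
  have hk (k : ℤ) : ‖mul u v k‖ ^ 2 ≤ D * ∑' j, p j * r (k - j) := by
    -- Cauchy–Schwarz is applied after inserting (1 + j²)^{-1/4}(1 + (k-j)²)^{-1/4} and its inverse.
    -- By AM–GM, f² is at most the average of two shifted copies of (1 + j²)⁻¹, so ∑ f² ≤ D
    -- uniformly in k.
    let f : ℤ → ℝ := fun j => weight (-(1 / 2)) j * weight (-(1 / 2)) (k - j)
    let g : ℤ → ℝ := fun j =>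
      weight (1 / 2) j * ‖u j‖ * (weight (1 / 2) (k - j) * ‖v (k - j)‖)
    have hf0 (j : ℤ) : 0 ≤ f j := (mul_pos (weight_pos _ _) (weight_pos _ _)).le
    have hg0 (j : ℤ) : 0 ≤ g j := by
      have h1 := weight_pos (1 / 2) j
      have h2 := weight_pos (1 / 2) (k - j)
      positivity
    have hf2 (j : ℤ) : f j ^ 2 ≤
        2⁻¹ * ((1 + (j : ℝ) ^ 2)⁻¹ + (1 + ((k - j : ℤ) : ℝ) ^ 2)⁻¹) := by
      have e (i : ℤ) : (weight (-(1 / 2)) i ^ 2) ^ 2 = (1 + (i : ℝ) ^ 2)⁻¹ := by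
        rw [weight_sq, ← Real.rpow_natCast, ← Real.rpow_mul (one_add_sq_pos i).le,
          ← Real.rpow_neg_one]
        norm_num
      rw [← e, ← e]
      simp only [f]
      rw [mul_pow]
      nlinarith [sq_nonneg (weight (-(1 / 2)) j ^ 2 - weight (-(1 / 2)) (k - j) ^ 2)]
    have hsum := (summable_inv_one_add_sq.add (summable_comp_sub summable_inv_one_add_sq k)).mul_left
      (2⁻¹ : ℝ)
    have hfs : Summable fun j => f j ^ 2 :=
      Summable.of_nonneg_of_le (fun j => sq_nonneg _) hf2 hsum
    have hfD : ∑' j, f j ^ 2 ≤ D := by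
      refine (hfs.tsum_le_tsum hf2 hsum).trans (le_of_eq ?_)
      rw [tsum_mul_left, summable_inv_one_add_sq.tsum_add
        (summable_comp_sub summable_inv_one_add_sq k),
        tsum_comp_sub (fun j : ℤ => (1 + (j : ℝ) ^ 2)⁻¹)]
      change 2⁻¹ * (D + D) = D
      ring
    have hg2 (j : ℤ) : g j ^ 2 = p j * r (k - j) := by
      simp only [g, p, r]
      rw [mul_pow, weight_mul_norm_sq, weight_mul_norm_sq]
    have hfg (j : ℤ) : f j * g j = ‖u j‖ * ‖v (k - j)‖ := by
      have e (i : ℤ) : weight (-(1 / 2)) i * weight (1 / 2) i = 1 := by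
        rw [weight_mul, neg_add_cancel, weight_zero]
      calc f j * g j = (weight (-(1 / 2)) j * weight (1 / 2) j) *
          (weight (-(1 / 2)) (k - j) * weight (1 / 2) (k - j)) * (‖u j‖ * ‖v (k - j)‖) := by
            simp only [f, g]; ring
        _ = _ := by rw [e, e]; ring
    have h := (summable_mul_and_sq_tsum_mul_le hf0 hg0 hfs (by simpa only [hg2] using hpr k)).2
    simp only [hg2, hfg] at h
    refine (pow_le_pow_left₀ (norm_nonneg _) (norm_mul_le_tsum hu0 hv0 k) 2).trans (h.trans ?_)
    gcongr
  calc ∑ k ∈ S, ‖mul u v k‖ ^ 2 ≤ ∑ k ∈ S, D * ∑' j, p j * r (k - j) :=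
        Finset.sum_le_sum fun k _ => hk k
    _ = D * ∑' j, ∑ k ∈ S, p j * r (k - j) := by
        rw [← Finset.mul_sum, Summable.tsum_finsetSum fun k _ => hpr k]
    _ ≤ D * ∑' j, p j * energy (1 / 2) v := by
        refine mul_le_mul_of_nonneg_left ?_ hD0
        refine (summable_sum fun k _ => hpr k).tsum_le_tsum (fun j => ?_)
          (Summable.mul_right _ (show Summable p from hu))
        rw [← Finset.mul_sum]
        refine mul_le_mul_of_nonneg_left ?_ (hp0 j)
        have hr : Summable fun k => r (k - j) := (Equiv.subRight j).summable_iff.2 hv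
        refine (hr.sum_le_tsum S fun i _ => hr0 _).trans (le_of_eq ?_)
        exact (Equiv.subRight j).tsum_eq r
    _ = D * (energy (1 / 2) u * energy (1 / 2) v) := by rw [tsum_mul_right]; rfl

end ProductEstimates

/-! ### The a priori L² bound for nonnegative symbols. -/

section APriori

/-- `∑_{|k| > N} (1 + k²)⁻¹`. -/
noncomputable def tail (N : ℝ) : ℝ :=
  ∑' k : ℤ, if N < |(k : ℝ)| then (1 + (k : ℝ) ^ 2)⁻¹ else 0

theorem tail_term_nonneg (N : ℝ) (k : ℤ) :
    0 ≤ if N < |(k : ℝ)| then (1 + (k : ℝ) ^ 2)⁻¹ else 0 := by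
  have := one_add_sq_pos k
  positivity

theorem tail_term_le (N : ℝ) (k : ℤ) :
    (if N < |(k : ℝ)| then (1 + (k : ℝ) ^ 2)⁻¹ else 0) ≤ (1 + (k : ℝ) ^ 2)⁻¹ := by
  have := one_add_sq_pos k
  split_ifs
  · exact le_rfl
  · positivity

theorem summable_tail (N : ℝ) :
    Summable fun k : ℤ => if N < |(k : ℝ)| then (1 + (k : ℝ) ^ 2)⁻¹ else 0 :=
  Summable.of_nonneg_of_le (tail_term_nonneg N) (tail_term_le N) summable_inv_one_add_sq

theorem tail_nonneg (N : ℝ) : 0 ≤ tail N := tsum_nonneg (tail_term_nonneg N)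

theorem tendsto_tail : Filter.Tendsto tail Filter.atTop (nhds 0) := by
  have h := tendsto_tsum_of_dominated_convergence (𝓕 := Filter.atTop)
    (f := fun (N : ℝ) (k : ℤ) => if N < |(k : ℝ)| then (1 + (k : ℝ) ^ 2)⁻¹ else 0)
    (g := fun _ => 0) summable_inv_one_add_sq (fun k => ?_) (Filter.Eventually.of_forall fun N k => ?_)
  · rw [tsum_zero] at h
    exact h
  · refine tendsto_const_nhds.congr' ?_
    filter_upwards [Filter.eventually_ge_atTop |(k : ℝ)|] with N hN
    rw [if_neg (not_lt.2 hN)]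
  · rw [Real.norm_of_nonneg (tail_term_nonneg N k)]
    exact tail_term_le N k

/-- Source of the smallness for large N: B differs from the identity only at |k| > N/2, and ∂⁻¹
supplies the summable factor (1 + k²)⁻¹ there. -/
theorem exists_tail_half_le {ε : ℝ} (hε : 0 < ε) : ∃ N₀ : ℝ, ∀ N, N₀ ≤ N → tail (N / 2) ≤ ε := by
  have h : Filter.Tendsto (fun N : ℝ => tail (N / 2)) Filter.atTop (nhds 0) :=
    tendsto_tail.comp (Filter.tendsto_id.atTop_div_const two_pos)
  obtain ⟨N₀, h⟩ := Filter.eventually_atTop.1 (h.eventually_le_const hε)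
  exact ⟨N₀, h⟩

variable {w z : Coeffs}

theorem norm_deriv_sq (w : Coeffs) (k : ℤ) : ‖deriv w k‖ ^ 2 = (k : ℝ) ^ 2 * ‖w k‖ ^ 2 := by
  simp [deriv, mul_pow]

theorem energy_one_eq (hw : w.support.Finite) :
    energy 1 w = energy 0 w + ∑' k, ‖deriv w k‖ ^ 2 := by
  rw [energy_zero, energy, ← Summable.tsum_add]
  · refine tsum_congr fun k => ?_
    rw [norm_deriv_sq, Real.rpow_one]
    ring
  · exact finiteEnergy_zero_iff.1 (finiteEnergy_of_support_finite 0 hw)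
  · exact finiteEnergy_zero_iff.1 (finiteEnergy_of_support_finite 0 (support_deriv_finite hw))

/-- Interpolation of `H^{1/2}` between `L²` and `H¹`. -/
theorem energy_half_le (hw : w.support.Finite) {ε : ℝ} (hε : 0 < ε) :
    energy (1 / 2) w ≤ ε * energy 1 w + 1 / (4 * ε) * energy 0 w := by
  have h0 := finiteEnergy_of_support_finite 0 hw
  have h1 := finiteEnergy_of_support_finite 1 hw
  rw [energy, energy, energy, ← tsum_mul_left, ← tsum_mul_left,
    ← (h1.mul_left ε).tsum_add (h0.mul_left _)]
  refine (finiteEnergy_of_support_finite (1 / 2) hw).tsum_le_tsum (fun k => ?_)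
    ((h1.mul_left ε).add (h0.mul_left _))
  rw [Real.rpow_one, Real.rpow_zero, one_mul, ← mul_assoc, ← add_mul]
  gcongr
  rw [← Real.sqrt_eq_rpow]
  have hsq := Real.sq_sqrt (one_add_sq_pos k).le
  generalize √(1 + (k : ℝ) ^ 2) = x at hsq ⊢
  rw [← hsq]
  have h3 : ε * x ^ 2 + 1 / (4 * ε) - x = (2 * ε * x - 1) ^ 2 / (4 * ε) := by
    field_simp
    ring
  have h4 : 0 ≤ (2 * ε * x - 1) ^ 2 / (4 * ε) := by positivity
  linarith

theorem mul_add_self (hw : FiniteEnergy 0 w) (hz : FiniteEnergy 0 z) :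
    mul (w + z) (w + z) = mul w w + ((2 : ℝ) • mul w z + mul z z) := by
  have hwz : FiniteEnergy 0 (w + z) := by
    rw [finiteEnergy_zero_iff] at hw hz ⊢
    refine Summable.of_nonneg_of_le (fun k => sq_nonneg _) (fun k => ?_)
      ((hw.add hz).mul_left 2)
    refine (pow_le_pow_left₀ (norm_nonneg _) (norm_add_le (w k) (z k)) 2).trans add_sq_le
  rw [mul_add_coeffs hwz hw hz, mul_comm_coeffs _ w, mul_comm_coeffs _ z, mul_add_coeffs hw hw hz,
    mul_add_coeffs hz hw hz, mul_comm_coeffs z w]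
  module

theorem norm_two_smul_add_sq_le (a b : ℂ) : ‖(2 : ℝ) • a + b‖ ^ 2 ≤ 8 * ‖a‖ ^ 2 + 2 * ‖b‖ ^ 2 := by
  have h := norm_add_le ((2 : ℝ) • a) b
  rw [norm_smul, Real.norm_eq_abs, abs_two] at h
  nlinarith [norm_nonneg ((2 : ℝ) • a + b), sq_nonneg (2 * ‖a‖ - ‖b‖)]

/-- The `L²` bound for the cross terms in `(w + z)²`. -/
theorem sum_norm_cross_sq_le (hw : FiniteEnergy (1 / 2) w) (hz : FiniteEnergy (1 / 2) z) {Z : ℝ}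
    (hZ : energy (1 / 2) z ≤ Z) (S : Finset ℤ) :
    ∑ k ∈ S, ‖((2 : ℝ) • mul w z + mul z z) k‖ ^ 2 ≤
      (∑' k : ℤ, (1 + (k : ℝ) ^ 2)⁻¹) * (8 * Z * energy (1 / 2) w + 2 * Z ^ 2) := by
  have hD0 : 0 ≤ ∑' k : ℤ, (1 + (k : ℝ) ^ 2)⁻¹ :=
    tsum_nonneg fun k => by have := one_add_sq_pos k; positivity
  have hz0 := energy_nonneg (1 / 2) z
  have hw0 := energy_nonneg (1 / 2) w
  calc ∑ k ∈ S, ‖((2 : ℝ) • mul w z + mul z z) k‖ ^ 2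
      ≤ ∑ k ∈ S, (8 * ‖mul w z k‖ ^ 2 + 2 * ‖mul z z k‖ ^ 2) :=
        Finset.sum_le_sum fun k _ => norm_two_smul_add_sq_le _ _
    _ = 8 * ∑ k ∈ S, ‖mul w z k‖ ^ 2 + 2 * ∑ k ∈ S, ‖mul z z k‖ ^ 2 := by
        rw [Finset.sum_add_distrib, Finset.mul_sum, Finset.mul_sum]
    _ ≤ 8 * ((∑' k : ℤ, (1 + (k : ℝ) ^ 2)⁻¹) * (energy (1 / 2) w * Z)) +
          2 * ((∑' k : ℤ, (1 + (k : ℝ) ^ 2)⁻¹) * (Z * Z)) := by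
        gcongr
        · exact (sum_norm_mul_sq_le hw hz S).trans (by gcongr)
        · exact (sum_norm_mul_sq_le hz hz S).trans (by gcongr; linarith)
    _ = _ := by ring

/-- The energy inequality obtained by pairing the equation with `v²`. -/
theorem tsum_norm_deriv_sq_le {b : ℤ → ℝ} {C₀ : ℝ} {S : Finset ℤ} (hb0 : ∀ k, 0 ≤ b k)
    (hb1 : ∀ k, b k ≤ C₀) (hbS : ∀ k ∉ S, b k = 0) (hw : w.support.Finite) (hwr : IsRealValued w)
    {q : Coeffs} (h : ∀ k, deriv w k = -(b k * (mul w w k + q k))) :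
    ∑' k, ‖deriv w k‖ ^ 2 ≤ C₀ ^ 2 * ∑ k ∈ S, ‖q k‖ ^ 2 := by
  have hC₀ : 0 ≤ C₀ := (hb0 0).trans (hb1 0)
  have hg (k : ℤ) (hk : k ∉ S) : deriv w k = 0 := by rw [h, hbS k hk]; simp
  -- This is ∫ w² w_x = 0 in Plancherel form.
  have hpair : (∑ k ∈ S, mul w w k * conj (deriv w k)).re = 0 := by
    rw [← mul_mul_deriv_zero hw hwr, mul, tsum_eq_sum (s := S)]
    · congr 1
      refine Finset.sum_congr rfl fun k _ => ?_
      rw [zero_sub, hwr.deriv]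
    · intro k hk
      rw [zero_sub, hwr.deriv, hg k hk]
      simp
  have hre (k : ℤ) : (mul w w k * conj (deriv w k)).re =
      -(b k * ‖mul w w k + q k‖ ^ 2) + b k * (q k * conj (mul w w k + q k)).re := by
    rw [h k, ← Complex.normSq_eq_norm_sq]
    simp only [map_neg, map_mul, Complex.conj_ofReal, map_add, Complex.normSq_apply, Complex.mul_re,
      Complex.neg_re, Complex.neg_im, Complex.mul_im, Complex.add_re, Complex.add_im,
      Complex.conj_re, Complex.conj_im, Complex.ofReal_re, Complex.ofReal_im]
    ring
  -- Writing w² = (w² + q) - q, Young's inequality lets half of b|w² + q|² be absorbed; this needs b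
  -- ≥ 0.
  have hq (k : ℤ) : b k * (q k * conj (mul w w k + q k)).re ≤
      b k * (‖mul w w k + q k‖ ^ 2 / 2 + ‖q k‖ ^ 2 / 2) := by
    refine mul_le_mul_of_nonneg_left ?_ (hb0 k)
    refine (Complex.re_le_norm _).trans ?_
    rw [norm_mul, RCLike.norm_conj]
    nlinarith [sq_nonneg (‖mul w w k + q k‖ - ‖q k‖)]
  have hE : ∑ k ∈ S, b k * ‖mul w w k + q k‖ ^ 2 ≤ ∑ k ∈ S, b k * ‖q k‖ ^ 2 := by
    rw [Complex.re_sum] at hpair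
    simp_rw [hre] at hpair
    have h1 : ∑ k ∈ S, (-(b k * ‖mul w w k + q k‖ ^ 2) +
        b k * (q k * conj (mul w w k + q k)).re) ≤
        ∑ k ∈ S, (-(b k * ‖mul w w k + q k‖ ^ 2) / 2 + b k * ‖q k‖ ^ 2 / 2) :=
      Finset.sum_le_sum fun k _ => by linarith [hq k]
    rw [hpair, Finset.sum_add_distrib, ← Finset.sum_div, ← Finset.sum_div,
      Finset.sum_neg_distrib] at h1
    linarith
  calc ∑' k, ‖deriv w k‖ ^ 2 = ∑ k ∈ S, ‖deriv w k‖ ^ 2 :=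
        tsum_eq_sum fun k hk => by simp [hg k hk]
    _ ≤ ∑ k ∈ S, C₀ * (b k * ‖mul w w k + q k‖ ^ 2) := by
        refine Finset.sum_le_sum fun k _ => ?_
        rw [h k, norm_neg, norm_mul, mul_pow, Complex.norm_real, Real.norm_of_nonneg (hb0 k), sq,
          mul_assoc]
        gcongr
        · have := hb0 k
          positivity
        · exact hb1 k
    _ ≤ C₀ * ∑ k ∈ S, b k * ‖q k‖ ^ 2 := by
        rw [← Finset.mul_sum]
        gcongr
    _ ≤ C₀ * ∑ k ∈ S, C₀ * ‖q k‖ ^ 2 := by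
        gcongr with k
        exact hb1 k
    _ = _ := by rw [← Finset.mul_sum]; ring

/-- `L²` bound for `w²` away from the zero mode. -/
theorem tsum_norm_removeMean_mul_sq_le {N : ℝ} (hw : w.support.Finite) {q : Coeffs} {Γ : ℝ}
    (hq : ∀ S : Finset ℤ, ∑ k ∈ S, ‖q k‖ ^ 2 ≤ Γ)
    (h : ∀ k : ℤ, k ≠ 0 → |(k : ℝ)| ≤ N / 2 → deriv w k = -(mul w w k + q k)) :
    ∑' k, ‖removeMean (mul w w) k‖ ^ 2 ≤ 2 * ∑' k, ‖deriv w k‖ ^ 2 + 2 * Γ +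
      16 * (energy 1 w * energy 0 w) * tail (N / 2) := by
  have hww := support_removeMean_finite (support_mul_finite hw hw)
  have he0 := energy_nonneg 0 w
  have he1 := energy_nonneg 1 w
  -- Three regimes: the zero mode is removed; for |k| > N/2 the tame estimate with s = 1 gives 2·4·2
  -- = 16; for 0 < |k| ≤ N/2 the equation gives w² = -w_x - q.
  have hterm (k : ℤ) : ‖removeMean (mul w w) k‖ ^ 2 ≤ 2 * ‖deriv w k‖ ^ 2 + 2 * ‖q k‖ ^ 2 +
      16 * (energy 1 w * energy 0 w) *
        (if N / 2 < |(k : ℝ)| then (1 + (k : ℝ) ^ 2)⁻¹ else 0) := by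
    rw [removeMean_apply]
    have hk1 := one_add_sq_pos k
    split_ifs with hk hN hN
    · rw [norm_zero, zero_pow two_ne_zero]; positivity
    · rw [norm_zero, zero_pow two_ne_zero]; positivity
    · have h1 := weight_mul_norm_mul_sq_le zero_le_one (finiteEnergy_of_support_finite 1 hw)
        (finiteEnergy_of_support_finite 1 hw) k
      rw [Real.rpow_one, Real.rpow_one] at h1
      have h2 : ‖mul w w k‖ ^ 2 ≤ 16 * (energy 1 w * energy 0 w) * (1 + (k : ℝ) ^ 2)⁻¹ := by
        rw [← div_eq_mul_inv, le_div_iff₀ hk1]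
        linarith
      have h3 : 0 ≤ 2 * ‖deriv w k‖ ^ 2 + 2 * ‖q k‖ ^ 2 := by positivity
      linarith
    · have e : mul w w k = -deriv w k - q k := by rw [h k hk (not_lt.1 hN)]; ring
      have h1 : ‖mul w w k‖ ≤ ‖deriv w k‖ + ‖q k‖ := by
        rw [e]
        exact (norm_sub_le _ _).trans (by rw [norm_neg])
      have h2 := (pow_le_pow_left₀ (norm_nonneg _) h1 2).trans add_sq_le
      linarith
  have hg : Summable fun k => ‖deriv w k‖ ^ 2 :=
    finiteEnergy_zero_iff.1 (finiteEnergy_of_support_finite 0 (support_deriv_finite hw))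
  rw [tsum_eq_sum (s := hww.toFinset) fun k hk => by
    have : removeMean (mul w w) k = 0 := by simpa using hk
    simp [this]]
  refine (Finset.sum_le_sum fun k _ => hterm k).trans ?_
  rw [Finset.sum_add_distrib, Finset.sum_add_distrib, ← Finset.mul_sum, ← Finset.mul_sum,
    ← Finset.mul_sum]
  gcongr
  · exact hg.sum_le_tsum _ fun _ _ => sq_nonneg _
  · exact hq _
  · exact (summable_tail (N / 2)).sum_le_tsum _ fun k _ => tail_term_nonneg _ k

/-- With μ = ‖w‖², G = ‖w_x‖² and e the H^{1/2} energy, taking ε = 1/(2(P + 1)) gives Pε ≤ 1/2, so G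
on the right is absorbed. -/
theorem le_of_interpolation {P G μ e T : ℝ} (hP : 0 ≤ P) (hμ : 0 ≤ μ) (hG : 0 ≤ G) (hT : 0 ≤ T)
    (he : ∀ ε, 0 < ε → e ≤ ε * (μ + G) + 1 / (4 * ε) * μ) (h : G ≤ P * e + T) :
    G ≤ (1 + P * (P + 1) + 2 * T) * (1 + μ) := by
  have h3 := mul_le_mul_of_nonneg_left (he (1 / (2 * (P + 1))) (by positivity)) hP
  have h4 : P * (1 / (2 * (P + 1)) * (μ + G) + 1 / (4 * (1 / (2 * (P + 1)))) * μ) =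
      P / (P + 1) * ((μ + G) / 2) + P * (P + 1) / 2 * μ := by
    field_simp
    ring
  have h5 : P / (P + 1) * ((μ + G) / 2) ≤ 1 * ((μ + G) / 2) := by
    gcongr
    rw [div_le_one (by positivity)]
    linarith
  have h6 : 0 ≤ P * (P + 1) := by positivity
  have h7 : 0 ≤ T * μ := by positivity
  linarith

/-- For μ > 1 the product HG is O(μ²) plus a multiple of τμ³. Smallness of τ makes the cubic part at
most μ³/2, leaving μ bounded. -/
theorem le_of_pow_three_le {A C₁ C₂ τ μ G H : ℝ} (hG0 : 0 ≤ G) (hτ0 : 0 ≤ τ)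
    (hA : 0 < A) (hC₁ : 0 < C₁) (hC₂ : 0 ≤ C₂)
    (hG : G ≤ C₁ * (1 + μ)) (hτ : 64 * A * C₁ * (1 + C₁) * τ ≤ 1 / 2)
    (hH : H ≤ 2 * (C₁ + C₂) * (1 + μ) + 16 * ((1 + C₁) * (1 + μ) * μ * τ))
    (hcube : μ ^ 3 ≤ A * (H * G)) : μ ≤ max 1 (16 * A * C₁ * (C₁ + C₂)) := by
  by_contra! hlt
  obtain ⟨hμ1, hμ2⟩ := max_lt_iff.1 hlt
  have k1 : 1 + μ ≤ 2 * μ := by linarith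
  have k2 : G ≤ C₁ * (2 * μ) := hG.trans (by gcongr)
  have k4 : H ≤ 2 * (C₁ + C₂) * (2 * μ) + 16 * ((1 + C₁) * (2 * μ) * μ * τ) :=
    hH.trans (by gcongr)
  have k6 : μ ^ 3 ≤ A * ((2 * (C₁ + C₂) * (2 * μ) + 16 * ((1 + C₁) * (2 * μ) * μ * τ)) *
      (C₁ * (2 * μ))) := by
    refine hcube.trans ?_
    gcongr
  have k7 : A * ((2 * (C₁ + C₂) * (2 * μ) + 16 * ((1 + C₁) * (2 * μ) * μ * τ)) *
      (C₁ * (2 * μ))) =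
      8 * A * C₁ * (C₁ + C₂) * μ ^ 2 + 64 * A * C₁ * (1 + C₁) * τ * μ ^ 3 := by ring
  have k8 : 64 * A * C₁ * (1 + C₁) * τ * μ ^ 3 ≤ 1 / 2 * μ ^ 3 := by gcongr
  have k9 : 16 * A * C₁ * (C₁ + C₂) * μ ^ 2 < μ * μ ^ 2 := by gcongr
  linarith

/-- A priori `L²` bound for the smooth part `w` of the solution `v = w + z` of
`v + ∂⁻¹ B(v²) = z`. -/
theorem exists_energy_zero_le (C₀ Z : ℝ) (hC₀ : 0 ≤ C₀) (hZ0 : 0 ≤ Z) : ∃ N₀ Λ : ℝ, 0 ≤ Λ ∧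
    ∀ N, N₀ ≤ N → ∀ b : ℤ → ℝ,
    (∀ k, 0 ≤ b k) → (∀ k, b k ≤ C₀) → (∀ k : ℤ, |(k : ℝ)| ≤ N / 2 → b k = 1) →
    b.support.Finite → ∀ w z : Coeffs, IsRealValued w → FiniteEnergy (1 / 2) z →
    energy (1 / 2) z ≤ Z → w = -antideriv (multiplier b (mul (w + z) (w + z))) →
    energy 0 w ≤ Λ := by
  set D : ℝ := ∑' k : ℤ, (1 + (k : ℝ) ^ 2)⁻¹ with hD
  have hD0 : 0 ≤ D := tsum_nonneg fun k => by have := one_add_sq_pos k; positivity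
  -- `P` is the coefficient of the H^{1/2} energy of w in the bound for ‖w_x‖². `C₁` and `C₂` will
  -- bound ‖w_x‖² and ‖q‖² by multiples of 1 + ‖w‖²; `A` comes from the cubic inequality.
  set P : ℝ := 8 * C₀ ^ 2 * D * Z with hP
  have hP0 : 0 ≤ P := by positivity
  set C₁ : ℝ := 1 + P * (P + 1) + 4 * C₀ ^ 2 * D * Z ^ 2 with hC₁
  have hC₁0 : 0 < C₁ := by positivity
  set C₂ : ℝ := D * (8 * Z * (1 + C₁) + 2 * Z ^ 2) with hC₂
  have hC₂0 : 0 ≤ C₂ := by positivity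
  set A : ℝ := 9 / 4 * (2 * Real.pi) ^ 2 with hA
  have hA0 : 0 < A := by positivity
  obtain ⟨N₀, hN₀⟩ := exists_tail_half_le (ε := 1 / (128 * A * C₁ * (1 + C₁))) (by positivity)
  refine ⟨N₀, max 1 (16 * A * C₁ * (C₁ + C₂)), by positivity,
    fun N hN b hb0 hbC hb1 hbs w z hwr hz hzZ hwz => ?_⟩
  have hτ := hN₀ N hN
  have hτ0 := tail_nonneg (N / 2)
  set τ := tail (N / 2)
  have hw : w.support.Finite := by
    refine hbs.subset fun k hk h => hk ?_
    rw [hwz]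
    simp [antideriv, multiplier, h]
  have hw0 : w 0 = 0 := by rw [hwz]; simp [antideriv]
  have hwh := finiteEnergy_of_support_finite (1 / 2) hw
  set q : Coeffs := (2 : ℝ) • mul w z + mul z z with hq
  have hsplit : mul (w + z) (w + z) = mul w w + q :=
    mul_add_self (finiteEnergy_of_support_finite 0 hw) (hz.mono (by norm_num))
  rw [hsplit] at hwz
  have hder (k : ℤ) (hk : k ≠ 0) : deriv w k = -(b k * (mul w w k + q k)) := by
    have h := congrFun hwz k
    rw [deriv, h]
    simp only [Pi.neg_apply, antideriv, multiplier, Pi.add_apply]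
    have : Complex.I * (k : ℂ) ≠ 0 := by simp [hk]
    field_simp
  set μ := energy 0 w with hμ
  have hμ0 : 0 ≤ μ := energy_nonneg 0 w
  set G := ∑' k, ‖deriv w k‖ ^ 2 with hG
  have hG0 : 0 ≤ G := tsum_nonneg fun k => sq_nonneg _
  have hE1 : energy 1 w = μ + G := energy_one_eq hw
  have hcross := sum_norm_cross_sq_le hwh hz hzZ
  have hGq : G ≤ C₀ ^ 2 * (D * (8 * Z * energy (1 / 2) w + 2 * Z ^ 2)) := by
    -- The equation for w_x holds only off the zero mode; setting the symbol to 0 there makes it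
    -- hold for every k.
    refine (tsum_norm_deriv_sq_le (b := fun k => if k = 0 then 0 else b k) (C₀ := C₀)
      (S := hbs.toFinset) (q := q) ?_ ?_ ?_ hw hwr ?_).trans
      (mul_le_mul_of_nonneg_left (hcross _) (by positivity))
    · intro k
      split_ifs
      exacts [le_rfl, hb0 k]
    · intro k
      split_ifs
      exacts [hC₀, hbC k]
    · intro k hk
      have : b k = 0 := by simpa using hk
      simp [this]
    · intro k
      by_cases hk : k = 0
      · simp [hk, deriv]
      · simp only [hk, if_false]
        exact hder k hk
  have hG1 : G ≤ C₁ * (1 + μ) := by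
    have h2 : G ≤ P * energy (1 / 2) w + 2 * C₀ ^ 2 * D * Z ^ 2 := by
      refine hGq.trans (le_of_eq ?_)
      rw [hP]; ring
    have h := le_of_interpolation hP0 hμ0 hG0 (by positivity)
      (fun ε hε => by have h1 := energy_half_le hw hε; rwa [hE1] at h1) h2
    refine h.trans (le_of_eq ?_)
    rw [hC₁]; ring
  have hμG : μ + G ≤ (1 + C₁) * (1 + μ) := by nlinarith
  have hΓ (S : Finset ℤ) : ∑ k ∈ S, ‖q k‖ ^ 2 ≤ C₂ * (1 + μ) := by
    refine (hcross S).trans ?_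
    have h1 : energy (1 / 2) w ≤ (1 + C₁) * (1 + μ) := by
      refine (energy_mono (by norm_num) (finiteEnergy_of_support_finite 1 hw)).trans ?_
      rw [hE1]; exact hμG
    rw [hC₂, mul_assoc D]
    refine mul_le_mul_of_nonneg_left ?_ hD0
    have h2 := mul_le_mul_of_nonneg_left h1 (show 0 ≤ 8 * Z by positivity)
    have h3 : 0 ≤ 2 * Z ^ 2 * μ := by positivity
    linarith
  have hH := tsum_norm_removeMean_mul_sq_le (N := N) hw hΓ fun k hk hkN => by
    rw [hder k hk, hb1 k hkN]; simp
  have hcube := tsum_sq_pow_three_le hw hwr hw0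
  rw [← energy_zero, ← hμ, ← hG, ← hA] at hcube
  rw [← hG, hE1, ← hμ] at hH
  set H := ∑' k, ‖removeMean (mul w w) k‖ ^ 2
  refine le_of_pow_three_le (τ := τ) hG0 hτ0 hA0 hC₁0 hC₂0 hG1 ?_ ?_ hcube
  · rw [le_div_iff₀ (by positivity)] at hτ
    linarith
  · refine hH.trans ?_
    have h1 := mul_le_mul_of_nonneg_right (mul_le_mul_of_nonneg_right hμG hμ0) hτ0
    linarith

end APriori

/-! ### A Banach space model of the Sobolev spaces. -/

section SobolevSpace

/-- The real Banach space of square summable sequences `x` with `x(-k) = conj x(k)` and `x(0) = 0`.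
It is a model of `H^s_0`, with `x(k) = (1 + k²)^{s/2} û(k)`. -/
noncomputable def realL2 : Submodule ℝ (lp (fun _ : ℤ => ℂ) 2) where
  carrier := {x | IsRealValued x ∧ x 0 = 0}
  add_mem' {x y} hx hy := by
    refine ⟨fun k => ?_, ?_⟩
    · simp [hx.1 k, hy.1 k]
    · simp [hx.2, hy.2]
  zero_mem' := ⟨fun k => by simp, by simp⟩
  smul_mem' c x hx := by
    refine ⟨fun k => ?_, ?_⟩
    · simp [hx.1 k]
    · simp [hx.2]

theorem continuous_lp_apply (k : ℤ) : Continuous fun x : lp (fun _ : ℤ => ℂ) 2 => x k :=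
  (continuous_apply k).comp lp.uniformContinuous_coe.continuous

theorem isClosed_realL2 : IsClosed (realL2 : Set (lp (fun _ : ℤ => ℂ) 2)) := by
  have h : (realL2 : Set (lp (fun _ : ℤ => ℂ) 2)) =
      (⋂ k : ℤ, {x | x (-k) = conj (x k)}) ∩ {x | x 0 = 0} := by
    ext x
    simp only [Set.mem_inter_iff, Set.mem_iInter, Set.mem_ofPred_eq]
    rfl
  rw [h]
  refine IsClosed.inter (isClosed_iInter fun k => ?_) ?_
  · exact isClosed_eq (continuous_lp_apply _)
      (Complex.continuous_conj.comp (continuous_lp_apply _))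
  · exact isClosed_eq (continuous_lp_apply _) continuous_const

noncomputable instance : CompleteSpace realL2 := isClosed_realL2.completeSpace_coe

/-- The Fourier coefficients of the element of `H^s_0` represented by `x`. -/
noncomputable def coef (s : ℝ) (x : realL2) : Coeffs := fun k => (weight (-s) k : ℂ) * x.1 k

theorem norm_sq_eq_tsum (x : lp (fun _ : ℤ => ℂ) 2) : ‖x‖ ^ 2 = ∑' k, ‖x k‖ ^ 2 := by
  have h := lp.norm_rpow_eq_tsum (p := 2) (by norm_num) x
  simpa using h

theorem summable_norm_sq (x : lp (fun _ : ℤ => ℂ) 2) : Summable fun k => ‖x k‖ ^ 2 := by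
  have h := (lp.memℓp x).summable (by norm_num)
  simpa using h

theorem energy_term_coef (s : ℝ) (x : realL2) (k : ℤ) :
    (1 + (k : ℝ) ^ 2) ^ s * ‖coef s x k‖ ^ 2 = ‖x.1 k‖ ^ 2 := by
  have hw : weight s k * weight (-s) k = 1 := by rw [weight_mul, add_neg_cancel, weight_zero]
  rw [coef, norm_mul, Complex.norm_real, Real.norm_of_nonneg (weight_pos _ _).le, ← weight_sq,
    ← mul_pow, ← mul_assoc, hw, one_mul]

theorem energy_coef (s : ℝ) (x : realL2) : energy s (coef s x) = ‖x‖ ^ 2 := by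
  simp only [energy, energy_term_coef]
  exact (norm_sq_eq_tsum x.1).symm

theorem memHs0_coef (s : ℝ) (x : realL2) : MemHs0 s (coef s x) where
  summable := by
    simp only [energy_term_coef]
    exact summable_norm_sq x.1
  real_valued k := by
    rw [coef, weight_neg, x.2.1 k]
    simp [coef]
  mean_zero := by simp [coef, x.2.2]

theorem finiteEnergy_coef (s : ℝ) (x : realL2) : FiniteEnergy s (coef s x) :=
  (memHs0_coef s x).summable

theorem isRealValued_coef (s : ℝ) (x : realL2) : IsRealValued (coef s x) :=
  (memHs0_coef s x).real_valued

/-- The element of the model space that represents `u`. -/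
noncomputable def ofCoeffs (s : ℝ) (u : Coeffs) (hu : MemHs0 s u) : realL2 :=
  ⟨⟨fun k => (weight s k : ℂ) * u k, by
    refine (memℓp_gen_iff (by norm_num)).2 ?_
    refine hu.summable.congr fun k => ?_
    simp [abs_of_pos (weight_pos s k), mul_pow, weight_sq]⟩,
    fun k => by
      change (weight s (-k) : ℂ) * u (-k) = conj ((weight s k : ℂ) * u k)
      rw [weight_neg, hu.real_valued k]
      simp,
    by
      change (weight s 0 : ℂ) * u 0 = 0
      rw [hu.mean_zero, mul_zero]⟩

theorem coef_ofCoeffs (s : ℝ) (u : Coeffs) (hu : MemHs0 s u) : coef s (ofCoeffs s u hu) = u := by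
  ext k
  have hw : weight (-s) k * weight s k = 1 := by rw [weight_mul, neg_add_cancel, weight_zero]
  change (weight (-s) k : ℂ) * ((weight s k : ℂ) * u k) = u k
  rw [← mul_assoc, ← Complex.ofReal_mul, hw]
  simp

theorem coef_injective (s : ℝ) : Function.Injective (coef s) := by
  intro x y h
  ext k
  have hk := congrFun h k
  simp only [coef] at hk
  exact mul_left_cancel₀ (by exact_mod_cast (weight_pos (-s) k).ne') hk

theorem norm_ofCoeffs_sq (s : ℝ) (u : Coeffs) (hu : MemHs0 s u) :
    ‖ofCoeffs s u hu‖ ^ 2 = energy s u := by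
  rw [← energy_coef s, coef_ofCoeffs]

theorem coef_add (s : ℝ) (x y : realL2) : coef s (x + y) = coef s x + coef s y := by
  ext k
  simp [coef, mul_add]

theorem coef_sub (s : ℝ) (x y : realL2) : coef s (x - y) = coef s x - coef s y := by
  ext k
  simp [coef, mul_sub]

theorem coef_smul (s c : ℝ) (x : realL2) : coef s (c • x) = c • coef s x := by
  ext k
  simp [coef]
  ring

theorem energy_zero_coef_le {s : ℝ} (hs : 0 ≤ s) (x : realL2) :
    energy 0 (coef s x) ≤ ‖x‖ ^ 2 := by
  rw [← energy_coef s]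
  exact energy_mono hs (finiteEnergy_coef s x)

end SobolevSpace

/-! ### The bilinear operator ∂⁻¹B(vw). -/

section Bilinear

/-- The symbol `b` is even and bounded. -/
structure IsEvenBounded (b : ℤ → ℝ) : Prop where
  even : ∀ k, b (-k) = b k
  bounded : ∃ C, ∀ k, |b k| ≤ C

theorem IsEvenBounded.sub {b c : ℤ → ℝ} (hb : IsEvenBounded b) (hc : IsEvenBounded c) :
    IsEvenBounded (b - c) where
  even k := by simp [hb.even, hc.even]
  bounded := by
    obtain ⟨C, hC⟩ := hb.bounded
    obtain ⟨C', hC'⟩ := hc.bounded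
    exact ⟨C + C', fun k => (abs_sub _ _).trans (add_le_add (hC k) (hC' k))⟩

theorem isEvenBounded_one : IsEvenBounded 1 := ⟨fun _ => rfl, 1, fun k => by simp⟩

/-- The factor k⁻² ≤ 2(1 + k²)⁻¹ from ∂⁻¹ is itself summable, so a bound on each weighted
coefficient of `u` suffices. A symbol living on |k| > K gains the tail beyond K; K = -1 imposes no
restriction. -/
theorem energy_term_antideriv_le {b : ℤ → ℝ} {u : Coeffs} {s C M K : ℝ} (hM0 : 0 ≤ M)
    (hbC : ∀ k, |b k| ≤ C) (hK : ∀ k : ℤ, b k ≠ 0 → K < |(k : ℝ)|)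
    (hM : ∀ k : ℤ, b k ≠ 0 → (1 + (k : ℝ) ^ 2) ^ s * ‖u k‖ ^ 2 ≤ M) (k : ℤ) :
    (1 + (k : ℝ) ^ 2) ^ s * ‖antideriv (multiplier b u) k‖ ^ 2 ≤
      2 * C ^ 2 * M * if K < |(k : ℝ)| then (1 + (k : ℝ) ^ 2)⁻¹ else 0 := by
  have hk1 := one_add_sq_pos k
  by_cases hk : k = 0 ∨ b k = 0
  · have h0 : antideriv (multiplier b u) k = 0 := by
      rcases hk with hk | hk <;> simp [antideriv, multiplier, hk]
    rw [h0]
    simp only [norm_zero, ne_eq, OfNat.ofNat_ne_zero, not_false_eq_true, zero_pow, mul_zero]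
    split_ifs <;> positivity
  · rw [not_or] at hk
    rw [if_pos (hK k hk.2)]
    have hk0 : (0 : ℝ) < (k : ℝ) ^ 2 := by have : (k : ℝ) ≠ 0 := by exact_mod_cast hk.1
                                           positivity
    have hk2 : (1 : ℝ) ≤ (k : ℝ) ^ 2 := by
      have : (1 : ℤ) ≤ k ^ 2 := by have := sq_nonneg k; have : k ^ 2 ≠ 0 := by simp [hk.1]
                                   omega
      exact_mod_cast this
    have e : ‖antideriv (multiplier b u) k‖ ^ 2 = ((k : ℝ) ^ 2)⁻¹ * (b k ^ 2 * ‖u k‖ ^ 2) := by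
      simp [antideriv, multiplier, mul_pow]
    have h1 : ((k : ℝ) ^ 2)⁻¹ ≤ 2 * (1 + (k : ℝ) ^ 2)⁻¹ := by
      rw [← div_eq_mul_inv, inv_eq_one_div, div_le_div_iff₀ hk0 hk1]
      linarith
    have h2 : b k ^ 2 ≤ C ^ 2 := sq_le_sq' (neg_le_of_abs_le (hbC k)) (le_of_abs_le (hbC k))
    calc (1 + (k : ℝ) ^ 2) ^ s * ‖antideriv (multiplier b u) k‖ ^ 2
        = ((k : ℝ) ^ 2)⁻¹ * b k ^ 2 * ((1 + (k : ℝ) ^ 2) ^ s * ‖u k‖ ^ 2) := by rw [e]; ring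
      _ ≤ (2 * (1 + (k : ℝ) ^ 2)⁻¹) * C ^ 2 * M := by
          gcongr
          exact hM k hk.2
      _ = _ := by ring

theorem finiteEnergy_antideriv {b : ℤ → ℝ} {u : Coeffs} {s C M K : ℝ} (hM0 : 0 ≤ M)
    (hbC : ∀ k, |b k| ≤ C) (hK : ∀ k : ℤ, b k ≠ 0 → K < |(k : ℝ)|)
    (hM : ∀ k : ℤ, b k ≠ 0 → (1 + (k : ℝ) ^ 2) ^ s * ‖u k‖ ^ 2 ≤ M) :
    FiniteEnergy s (antideriv (multiplier b u)) ∧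
      energy s (antideriv (multiplier b u)) ≤ 2 * C ^ 2 * M * tail K := by
  have h := energy_term_antideriv_le hM0 hbC hK hM
  have hs := (summable_tail K).mul_left (2 * C ^ 2 * M)
  have hf : FiniteEnergy s (antideriv (multiplier b u)) :=
    Summable.of_nonneg_of_le (energy_term_nonneg _ _) h hs
  refine ⟨hf, (hf.tsum_le_tsum h hs).trans (le_of_eq ?_)⟩
  rw [tsum_mul_left, tail]

theorem IsRealValued.multiplier {b : ℤ → ℝ} {u : Coeffs} (hb : ∀ k, b (-k) = b k)
    (hu : IsRealValued u) : IsRealValued (TorusSobolev.multiplier b u) := by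
  intro k
  simp [TorusSobolev.multiplier, hb, hu k]

variable {s : ℝ} {b : ℤ → ℝ}

theorem weight_mul_coef_le (hs : 0 ≤ s) (x y : realL2) (k : ℤ) :
    (1 + (k : ℝ) ^ 2) ^ s * ‖mul (coef s x) (coef s y) k‖ ^ 2 ≤
      2 * 4 ^ s * (‖x‖ ^ 2 * energy 0 (coef s y) + energy 0 (coef s x) * ‖y‖ ^ 2) := by
  have h := weight_mul_norm_mul_sq_le hs (finiteEnergy_coef s x) (finiteEnergy_coef s y) k
  rwa [energy_coef, energy_coef] at h

theorem tame_nonneg (s : ℝ) (x y : realL2) :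
    0 ≤ 2 * 4 ^ s * (‖x‖ ^ 2 * energy 0 (coef s y) + energy 0 (coef s x) * ‖y‖ ^ 2) := by
  have h1 := energy_nonneg 0 (coef s x)
  have h2 := energy_nonneg 0 (coef s y)
  positivity

theorem memHs0_antideriv_mul (hs : 0 ≤ s) (hb : IsEvenBounded b) (x y : realL2) :
    MemHs0 s (antideriv (multiplier b (mul (coef s x) (coef s y)))) := by
  obtain ⟨C, hC⟩ := hb.bounded
  refine ⟨(finiteEnergy_antideriv (K := -1) (tame_nonneg s x y) hC (fun k _ => ?_)
    fun k _ => weight_mul_coef_le hs x y k).1,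
    (((isRealValued_coef s x).mul (isRealValued_coef s y)).multiplier hb.even).antideriv,
    by simp [antideriv]⟩
  linarith [abs_nonneg (k : ℝ)]

/-- The operator `(v, w) ↦ ∂⁻¹ B(v w)`, where `B` has symbol `b`, in the model space. -/
noncomputable def bilinFun (hs : 0 ≤ s) (hb : IsEvenBounded b) (x y : realL2) : realL2 :=
  ofCoeffs s _ (memHs0_antideriv_mul hs hb x y)

theorem coef_bilinFun (hs : 0 ≤ s) (hb : IsEvenBounded b) (x y : realL2) :
    coef s (bilinFun hs hb x y) = antideriv (multiplier b (mul (coef s x) (coef s y))) :=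
  coef_ofCoeffs _ _ _

/-- For high-frequency symbols the constant is small, and each term carries the full norm on one
factor only. -/
theorem norm_bilinFun_sq_le_tail (hs : 0 ≤ s) (hb : IsEvenBounded b) {C K : ℝ}
    (hC : ∀ k, |b k| ≤ C) (hK : ∀ k : ℤ, b k ≠ 0 → K < |(k : ℝ)|) (x y : realL2) :
    ‖bilinFun hs hb x y‖ ^ 2 ≤ 4 * 4 ^ s * C ^ 2 * tail K *
      (‖x‖ ^ 2 * energy 0 (coef s y) + energy 0 (coef s x) * ‖y‖ ^ 2) := by
  rw [bilinFun, norm_ofCoeffs_sq]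
  refine (finiteEnergy_antideriv (tame_nonneg s x y) hC hK
    fun k _ => weight_mul_coef_le hs x y k).2.trans (le_of_eq ?_)
  ring

/-- At frequencies |k| ≤ K the weight is bounded, so L² norms alone control the output. -/
theorem norm_bilinFun_sq_le_low (hs : 0 ≤ s) (hb : IsEvenBounded b) {C K : ℝ}
    (hC : ∀ k, |b k| ≤ C) (hK : ∀ k : ℤ, b k ≠ 0 → |(k : ℝ)| ≤ K) (x y : realL2) :
    ‖bilinFun hs hb x y‖ ^ 2 ≤ 2 * C ^ 2 * (1 + K ^ 2) ^ s * tail (-1) *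
      (energy 0 (coef s x) * energy 0 (coef s y)) := by
  have h1 := energy_nonneg 0 (coef s x)
  have h2 := energy_nonneg 0 (coef s y)
  have hK1 : 0 ≤ (1 + K ^ 2) ^ s := by positivity
  rw [bilinFun, norm_ofCoeffs_sq]
  refine (finiteEnergy_antideriv (M := (1 + K ^ 2) ^ s *
    (energy 0 (coef s x) * energy 0 (coef s y))) (K := -1) (by positivity) hC
    (fun k _ => by linarith [abs_nonneg (k : ℝ)]) fun k hk => ?_).2.trans (le_of_eq (by ring))
  have h3 := norm_mul_sq_le ((finiteEnergy_coef s x).mono hs) ((finiteEnergy_coef s y).mono hs) k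
  have h4 : (k : ℝ) ^ 2 ≤ K ^ 2 := by
    rw [← sq_abs (k : ℝ)]
    exact pow_le_pow_left₀ (abs_nonneg _) (hK k hk) 2
  gcongr

theorem multiplier_add (b : ℤ → ℝ) (u v : Coeffs) :
    multiplier b (u + v) = multiplier b u + multiplier b v := by
  ext k
  simp [multiplier, mul_add]

theorem antideriv_add (u v : Coeffs) : antideriv (u + v) = antideriv u + antideriv v := by
  ext k
  simp [antideriv, mul_add]

theorem multiplier_smul (b : ℤ → ℝ) (c : ℝ) (u : Coeffs) :
    multiplier b (c • u) = c • multiplier b u := by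
  ext k
  simp [multiplier]
  ring

theorem antideriv_smul (c : ℝ) (u : Coeffs) : antideriv (c • u) = c • antideriv u := by
  ext k
  simp [antideriv]
  ring

theorem bilinFun_comm (hs : 0 ≤ s) (hb : IsEvenBounded b) (x y : realL2) :
    bilinFun hs hb x y = bilinFun hs hb y x := by
  apply coef_injective s
  rw [coef_bilinFun, coef_bilinFun, mul_comm_coeffs]

theorem bilinFun_add (hs : 0 ≤ s) (hb : IsEvenBounded b) (x y z : realL2) :
    bilinFun hs hb x (y + z) = bilinFun hs hb x y + bilinFun hs hb x z := by
  apply coef_injective s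
  rw [coef_add, coef_bilinFun, coef_bilinFun, coef_bilinFun, coef_add,
    mul_add_coeffs ((finiteEnergy_coef s x).mono hs) ((finiteEnergy_coef s y).mono hs)
      ((finiteEnergy_coef s z).mono hs), multiplier_add, antideriv_add]

theorem bilinFun_smul (hs : 0 ≤ s) (hb : IsEvenBounded b) (c : ℝ) (x y : realL2) :
    bilinFun hs hb x (c • y) = c • bilinFun hs hb x y := by
  apply coef_injective s
  rw [coef_smul, coef_bilinFun, coef_bilinFun, coef_smul, mul_smul_coeffs, multiplier_smul,
    antideriv_smul]

theorem exists_norm_bilinFun_le (hs : 0 ≤ s) (hb : IsEvenBounded b) :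
    ∃ M : ℝ, ∀ x y, ‖bilinFun hs hb x y‖ ≤ M * ‖x‖ * ‖y‖ := by
  obtain ⟨C, hC⟩ := hb.bounded
  have ht := tail_nonneg (-1)
  refine ⟨√(8 * 4 ^ s * C ^ 2 * tail (-1)), fun x y => ?_⟩
  rw [← abs_of_nonneg (norm_nonneg (bilinFun hs hb x y))]
  refine abs_le_of_sq_le_sq ?_ (by positivity)
  rw [mul_pow, mul_pow, Real.sq_sqrt (by positivity)]
  refine (norm_bilinFun_sq_le_tail hs hb hC (K := -1)
    (fun k _ => by linarith [abs_nonneg (k : ℝ)]) x y).trans ?_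
  have h1 := energy_zero_coef_le hs x
  have h2 := energy_zero_coef_le hs y
  calc _ ≤ 4 * 4 ^ s * C ^ 2 * tail (-1) * (‖x‖ ^ 2 * ‖y‖ ^ 2 + ‖x‖ ^ 2 * ‖y‖ ^ 2) := by gcongr
    _ = _ := by ring

/-- The bounded bilinear map `(v, w) ↦ ∂⁻¹ B(v w)`. -/
noncomputable def bilin (hs : 0 ≤ s) (hb : IsEvenBounded b) : realL2 →L[ℝ] realL2 →L[ℝ] realL2 :=
  LinearMap.mkContinuous₂
    (LinearMap.mk₂ ℝ (bilinFun hs hb)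
      (fun x y z => by
        rw [bilinFun_comm, bilinFun_add, bilinFun_comm hs hb z x, bilinFun_comm hs hb z y])
      (fun c x y => by rw [bilinFun_comm, bilinFun_smul, bilinFun_comm])
      (bilinFun_add hs hb) (bilinFun_smul hs hb))
    (exists_norm_bilinFun_le hs hb).choose (exists_norm_bilinFun_le hs hb).choose_spec

theorem bilin_apply (hs : 0 ≤ s) (hb : IsEvenBounded b) (x y : realL2) :
    bilin hs hb x y = bilinFun hs hb x y := rfl

theorem coef_bilin (hs : 0 ≤ s) (hb : IsEvenBounded b) (x y : realL2) :
    coef s (bilin hs hb x y) = antideriv (multiplier b (mul (coef s x) (coef s y))) :=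
  coef_bilinFun hs hb x y

theorem bilin_comm (hs : 0 ≤ s) (hb : IsEvenBounded b) (x y : realL2) :
    bilin hs hb x y = bilin hs hb y x := bilinFun_comm hs hb x y

theorem bilin_sub (hs : 0 ≤ s) {c : ℤ → ℝ} (hb : IsEvenBounded b) (hc : IsEvenBounded c)
    (x y : realL2) : bilin hs (hb.sub hc) x y = bilin hs hb x y - bilin hs hc x y := by
  apply coef_injective s
  rw [coef_sub, coef_bilin, coef_bilin, coef_bilin]
  ext k
  simp [antideriv, multiplier, sub_mul, mul_sub]

end Bilinear

/-! ### Lower bounds for the linearizations, and the a priori bound in H^s. -/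

section LowerBounds

variable {s : ℝ}

/-- The representative in `L²` of the element of `H^s_0` represented by `x`. -/
noncomputable def toL2 (hs : 0 ≤ s) (x : realL2) : realL2 :=
  ofCoeffs 0 (coef s x) ⟨(finiteEnergy_coef s x).mono hs, isRealValued_coef s x,
    (memHs0_coef s x).mean_zero⟩

theorem coef_toL2 (hs : 0 ≤ s) (x : realL2) : coef 0 (toL2 hs x) = coef s x := coef_ofCoeffs _ _ _

theorem norm_toL2_sq (hs : 0 ≤ s) (x : realL2) : ‖toL2 hs x‖ ^ 2 = energy 0 (coef s x) :=
  norm_ofCoeffs_sq _ _ _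

theorem norm_toL2_le (hs : 0 ≤ s) (x : realL2) : ‖toL2 hs x‖ ≤ ‖x‖ := by
  refine le_of_sq_le_sq ?_ (norm_nonneg _)
  rw [norm_toL2_sq]
  exact energy_zero_coef_le hs x

theorem toL2_add (hs : 0 ≤ s) (x y : realL2) : toL2 hs (x + y) = toL2 hs x + toL2 hs y := by
  apply coef_injective 0
  simp only [coef_toL2, coef_add]

theorem toL2_smul (hs : 0 ≤ s) (c : ℝ) (x : realL2) : toL2 hs (c • x) = c • toL2 hs x := by
  apply coef_injective 0
  simp only [coef_toL2, coef_smul]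

theorem toL2_bilin (hs : 0 ≤ s) {b : ℤ → ℝ} (hb : IsEvenBounded b) (x y : realL2) :
    toL2 hs (bilin hs hb x y) = bilin le_rfl hb (toL2 hs x) (toL2 hs y) := by
  apply coef_injective 0
  simp only [coef_toL2, coef_bilin]

theorem coef_zero_apply (x : realL2) (k : ℤ) : coef 0 x k = x.1 k := by
  simp [coef, weight_zero]

/-- Truncation to the frequencies `|k| ≤ n`. -/
noncomputable def truncate (n : ℕ) (x : realL2) : realL2 :=
  ofCoeffs 0 (fun k => if |k| ≤ (n : ℤ) then x.1 k else 0)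
    ⟨finiteEnergy_of_support_finite 0 ((Set.finite_Icc (-n : ℤ) n).subset fun k hk => by
        by_contra h
        refine hk (if_neg fun h' => h (abs_le.1 h'))),
      fun k => by
        rw [abs_neg, x.2.1 k]
        split_ifs <;> simp,
      by simp [x.2.2]⟩

theorem coef_truncate (n : ℕ) (x : realL2) :
    coef 0 (truncate n x) = fun k => if |k| ≤ (n : ℤ) then x.1 k else 0 := coef_ofCoeffs _ _ _

theorem support_coef_truncate_finite (n : ℕ) (x : realL2) :
    (coef 0 (truncate n x)).support.Finite := by
  refine (Set.finite_Icc (-n : ℤ) n).subset fun k hk => ?_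
  by_contra h
  refine hk ?_
  rw [coef_truncate]
  exact if_neg fun h' => h (abs_le.1 h')

theorem norm_sq_eq_tsum_coef (x : realL2) : ‖x‖ ^ 2 = ∑' k, ‖coef 0 x k‖ ^ 2 := by
  rw [← energy_coef 0, energy_zero]

theorem norm_truncate_le (n : ℕ) (x : realL2) : ‖truncate n x‖ ≤ ‖x‖ := by
  refine le_of_sq_le_sq ?_ (norm_nonneg _)
  rw [norm_sq_eq_tsum_coef, norm_sq_eq_tsum_coef]
  refine Summable.tsum_le_tsum (fun k => ?_) (finiteEnergy_zero_iff.1 (finiteEnergy_coef 0 _))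
    (finiteEnergy_zero_iff.1 (finiteEnergy_coef 0 _))
  rw [coef_truncate, coef_zero_apply]
  dsimp only
  split_ifs
  · exact le_rfl
  · simp

theorem tendsto_truncate (x : realL2) :
    Filter.Tendsto (fun n => truncate n x) Filter.atTop (nhds x) := by
  rw [tendsto_iff_norm_sub_tendsto_zero]
  have h : Filter.Tendsto (fun n => ‖truncate n x - x‖ ^ 2) Filter.atTop (nhds 0) := by
    have h1 := tendsto_tsum_of_dominated_convergence (𝓕 := Filter.atTop)
      (f := fun (n : ℕ) (k : ℤ) => ‖coef 0 (truncate n x - x) k‖ ^ 2)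
      (g := fun _ => 0) (summable_norm_sq x.1) (fun k => ?_)
      (Filter.Eventually.of_forall fun n k => ?_)
    · rw [tsum_zero] at h1
      simpa only [norm_sq_eq_tsum_coef] using h1
    · refine tendsto_const_nhds.congr' ?_
      filter_upwards [Filter.eventually_ge_atTop k.natAbs] with n hn
      have : |k| ≤ (n : ℤ) := by rw [Int.abs_eq_natAbs]; exact_mod_cast hn
      rw [coef_sub, coef_truncate, Pi.sub_apply, coef_zero_apply]
      simp [this]
    · rw [coef_sub, coef_truncate, Pi.sub_apply, coef_zero_apply]
      split_ifs <;> simp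
  have h2 := (Real.continuous_sqrt.tendsto 0).comp h
  simpa [Function.comp_def] using h2

/-- v is z = v + 2∂⁻¹(av) plus -2∂⁻¹(av), and the ODE estimate bounds the second summand by the
first. -/
theorem exists_bddBelow_zero_of_support_finite (ρ : ℝ) : ∃ K : ℝ, 0 ≤ K ∧ ∀ a v : realL2,
    (coef 0 a).support.Finite → (coef 0 v).support.Finite → ‖a‖ ≤ ρ →
    ‖v‖ ≤ K * ‖v + (2 : ℝ) • bilin le_rfl isEvenBounded_one a v‖ := by
  obtain ⟨K, hK0, hK⟩ := exists_tsum_sq_antideriv_mul_le (ρ ^ 2)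
  refine ⟨1 + √K, by positivity, fun a v hasupp hvsupp ha => ?_⟩
  have hone (u : Coeffs) : multiplier 1 u = u := by ext k; simp [multiplier]
  have hQ : coef 0 (bilin le_rfl isEvenBounded_one a v) = antideriv (mul (coef 0 a) (coef 0 v)) := by
    rw [coef_bilin, hone]
  generalize bilin le_rfl isEvenBounded_one a v = Q at hQ ⊢
  have h := hK (coef 0 a) (coef 0 v) hasupp hvsupp
    (isRealValued_coef 0 _) (isRealValued_coef 0 _) (memHs0_coef 0 _).mean_zero (by
      rw [← norm_sq_eq_tsum_coef]
      exact pow_le_pow_left₀ (norm_nonneg _) ha 2)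
  rw [← hQ, ← coef_smul, ← coef_smul, ← coef_add, ← norm_sq_eq_tsum_coef,
    ← norm_sq_eq_tsum_coef] at h
  have h' : ‖(-2 : ℝ) • Q‖ ≤ √K * ‖v + (2 : ℝ) • Q‖ := by
    refine le_of_sq_le_sq ?_ (by positivity)
    rwa [mul_pow, Real.sq_sqrt hK0]
  have e : v = (v + (2 : ℝ) • Q) + (-2 : ℝ) • Q := by module
  have h3 := norm_add_le (v + (2 : ℝ) • Q) ((-2 : ℝ) • Q)
  rw [← e] at h3
  linarith

/-- The linearization of `v ↦ v + ∂⁻¹(v²)` is bounded below in `L²`. -/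
theorem exists_bddBelow_zero (ρ : ℝ) : ∃ K : ℝ, 0 ≤ K ∧ ∀ a v : realL2, ‖a‖ ≤ ρ →
    ‖v‖ ≤ K * ‖v + (2 : ℝ) • bilin le_rfl isEvenBounded_one a v‖ := by
  obtain ⟨K, hK0, hK⟩ := exists_bddBelow_zero_of_support_finite ρ
  refine ⟨K, hK0, fun a v ha => ?_⟩
  have hfin (n : ℕ) := hK (truncate n a) (truncate n v) (support_coef_truncate_finite n a)
    (support_coef_truncate_finite n v) ((norm_truncate_le n a).trans ha)
  generalize bilin le_rfl isEvenBounded_one = Q at hfin ⊢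
  -- `K` does not depend on the supports, so truncating a and v and passing to the limit removes the
  -- finiteness assumption.
  have hcont : Continuous fun p : realL2 × realL2 => p.2 + (2 : ℝ) • Q p.1 p.2 := by fun_prop
  refine le_of_tendsto_of_tendsto' (tendsto_truncate v).norm (Filter.Tendsto.const_mul _ ?_) hfin
  exact ((hcont.tendsto (a, v)).comp
    ((tendsto_truncate a).prodMk_nhds (tendsto_truncate v))).norm

/-- The symbol of the sharp projection to the frequencies `|k| ≤ K`. -/
noncomputable def lowSymbol (K : ℝ) (k : ℤ) : ℝ := if |(k : ℝ)| ≤ K then 1 else 0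

theorem isEvenBounded_lowSymbol (K : ℝ) : IsEvenBounded (lowSymbol K) where
  even k := by simp [lowSymbol]
  bounded := ⟨1, fun k => by rw [lowSymbol]; split_ifs <;> simp⟩

theorem exists_tail_le {ε : ℝ} (hε : 0 < ε) : ∃ K : ℝ, tail K ≤ ε := by
  obtain ⟨N₀, h⟩ := exists_tail_half_le hε
  exact ⟨_, h N₀ le_rfl⟩

/-- Splitting into low and high frequencies: up to a bilinear term in the `L²` norms, the bilinear
operator is small. -/
theorem exists_norm_bilin_le (hs : 0 ≤ s) (C : ℝ) {ε : ℝ} (hε : 0 < ε) : ∃ A : ℝ, 0 ≤ A ∧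
    ∀ (b : ℤ → ℝ) (hb : IsEvenBounded b), (∀ k, |b k| ≤ C) → ∀ x y : realL2,
    ‖bilin hs hb x y‖ ≤ A * (‖toL2 hs x‖ * ‖toL2 hs y‖) +
      ε * (‖x‖ * ‖toL2 hs y‖ + ‖toL2 hs x‖ * ‖y‖) := by
  -- The cutoff frequency makes the high part at most ε; the + 1 guards against C = 0.
  obtain ⟨K, hK⟩ := exists_tail_le (ε := ε ^ 2 / (4 * 4 ^ s * C ^ 2 + 1)) (by positivity)
  have ht := tail_nonneg (-1)
  refine ⟨√(2 * C ^ 2 * (1 + K ^ 2) ^ s * tail (-1)), by positivity, fun b hb hbC x y => ?_⟩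
  have hlow : IsEvenBounded (fun k => b k * lowSymbol K k) :=
    ⟨fun k => by rw [hb.even, (isEvenBounded_lowSymbol K).even], C, fun k => by
      rw [lowSymbol]
      split_ifs
      · simpa using hbC k
      · simpa using (abs_nonneg _).trans (hbC k)⟩
  have hlowC (k : ℤ) : |b k * lowSymbol K k| ≤ C := by
    rw [lowSymbol]
    split_ifs
    · simpa using hbC k
    · simpa using (abs_nonneg _).trans (hbC k)
  have hhighC (k : ℤ) : |(b - fun k => b k * lowSymbol K k) k| ≤ C := by
    rw [Pi.sub_apply, lowSymbol]
    split_ifs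
    · simpa using (abs_nonneg _).trans (hbC k)
    · simpa using hbC k
  have h1 := norm_bilinFun_sq_le_low hs hlow hlowC (K := K) (fun k hk => by
    by_contra h
    simp [lowSymbol, h] at hk) x y
  have h2 := norm_bilinFun_sq_le_tail hs (hb.sub hlow) hhighC (K := K) (fun k hk => by
    by_contra h
    simp [lowSymbol, not_lt.1 h] at hk) x y
  rw [← norm_toL2_sq hs, ← norm_toL2_sq hs, ← bilin_apply] at h1 h2
  have h1' : ‖bilin hs hlow x y‖ ≤
      √(2 * C ^ 2 * (1 + K ^ 2) ^ s * tail (-1)) * (‖toL2 hs x‖ * ‖toL2 hs y‖) := by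
    refine le_of_sq_le_sq ?_ (by positivity)
    rw [mul_pow, Real.sq_sqrt (by positivity), mul_pow]
    exact h1
  have h2' : ‖bilin hs (hb.sub hlow) x y‖ ≤ ε * (‖x‖ * ‖toL2 hs y‖ + ‖toL2 hs x‖ * ‖y‖) := by
    refine le_of_sq_le_sq ?_ (by positivity)
    have h3 : 4 * 4 ^ s * C ^ 2 * tail K ≤ ε ^ 2 := by
      have h4 := tail_nonneg K
      rw [le_div_iff₀ (by positivity)] at hK
      linarith
    refine h2.trans ?_
    rw [mul_pow]
    gcongr
    have h5 : 0 ≤ (‖x‖ * ‖toL2 hs y‖) * (‖toL2 hs x‖ * ‖y‖) := by positivity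
    linarith
  have e : bilin hs hb x y = bilin hs hlow x y + bilin hs (hb.sub hlow) x y := by
    rw [bilin_sub hs hb hlow]; abel
  rw [e]
  exact (norm_add_le _ _).trans (add_le_add h1' h2')

/-- Changing the symbol at the frequencies `|k| > N / 2` is a small perturbation. -/
theorem exists_norm_bilin_sub_le (hs : 0 ≤ s) (C : ℝ) {ε : ℝ} (hε : 0 < ε) : ∃ N₀ : ℝ,
    ∀ N, N₀ ≤ N → ∀ (b c : ℤ → ℝ) (hb : IsEvenBounded b) (hc : IsEvenBounded c),
    (∀ k, |b k| ≤ C) → (∀ k, |c k| ≤ C) → (∀ k : ℤ, |(k : ℝ)| ≤ N / 2 → b k = c k) →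
    ∀ x y : realL2, ‖bilin hs hb x y - bilin hs hc x y‖ ≤ ε * (‖x‖ * ‖y‖) := by
  obtain ⟨N₀, hN₀⟩ := exists_tail_half_le (ε := ε ^ 2 / (8 * 4 ^ s * (2 * C) ^ 2 + 1))
    (by positivity)
  refine ⟨N₀, fun N hN b c hb hc hbC hcC hbc x y => ?_⟩
  have ht := tail_nonneg (N / 2)
  have hτ := hN₀ N hN
  rw [le_div_iff₀ (by positivity)] at hτ
  have h := norm_bilinFun_sq_le_tail hs (hb.sub hc) (C := 2 * C) (K := N / 2)
    (fun k => (abs_sub _ _).trans (by linarith [hbC k, hcC k]))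
    (fun k hk => by
      by_contra h
      exact hk (by rw [Pi.sub_apply, hbc k (not_lt.1 h), sub_self])) x y
  rw [← bilin_apply, bilin_sub hs hb hc] at h
  refine le_of_sq_le_sq (h.trans ?_) (by positivity)
  have h1 := energy_zero_coef_le hs x
  have h2 := energy_zero_coef_le hs y
  calc _ ≤ 4 * 4 ^ s * (2 * C) ^ 2 * tail (N / 2) * (‖x‖ ^ 2 * ‖y‖ ^ 2 + ‖x‖ ^ 2 * ‖y‖ ^ 2) := by
        gcongr
    _ = tail (N / 2) * (8 * 4 ^ s * (2 * C) ^ 2) * (‖x‖ * ‖y‖) ^ 2 := by ring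
    _ ≤ ε ^ 2 * (‖x‖ * ‖y‖) ^ 2 := by
        gcongr
        linarith
    _ = _ := by ring

/-- The linearization of `v ↦ v + ∂⁻¹(v²)` is bounded below in `H^s`. -/
theorem exists_bddBelow_one (hs : 0 ≤ s) {ρ : ℝ} (hρ : 0 ≤ ρ) : ∃ K : ℝ, 0 < K ∧
    ∀ a v : realL2, ‖a‖ ≤ ρ → ‖v‖ ≤ K * ‖v + (2 : ℝ) • bilin hs isEvenBounded_one a v‖ := by
  obtain ⟨K, hK0, hK⟩ := exists_bddBelow_zero ρ
  -- Then 2ερ ≤ 1/2, so the high-frequency part of 2Q(a, v) is absorbed into ‖v‖; all other terms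
  -- involve v only through its L² norm.
  set ε : ℝ := 1 / (4 * (ρ + 1)) with hε
  have hε0 : 0 < ε := by positivity
  obtain ⟨A, hA0, hA⟩ := exists_norm_bilin_le hs 1 hε0
  refine ⟨2 * (1 + 2 * (A + ε) * ρ * K), by positivity, fun a v ha => ?_⟩
  set z := v + (2 : ℝ) • bilin hs isEvenBounded_one a v with hz
  have hv : v = z - (2 : ℝ) • bilin hs isEvenBounded_one a v := by rw [hz]; abel
  have h0 : ‖toL2 hs v‖ ≤ K * ‖z‖ := by
    have h1 := hK (toL2 hs a) (toL2 hs v) ((norm_toL2_le hs a).trans ha)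
    rw [← toL2_bilin, ← toL2_smul, ← toL2_add, ← hz] at h1
    exact h1.trans (mul_le_mul_of_nonneg_left (norm_toL2_le hs z) hK0)
  have h1 := hA 1 isEvenBounded_one (fun k => by simp) a v
  have ha0 := (norm_toL2_le hs a).trans ha
  have h2 : ‖bilin hs isEvenBounded_one a v‖ ≤
      A * (ρ * (K * ‖z‖)) + ε * (ρ * (K * ‖z‖) + ρ * ‖v‖) := h1.trans (by gcongr)
  have h3 : ε * ρ ≤ 1 / 4 := by
    rw [hε, one_div_mul_eq_div, div_le_div_iff₀ (by positivity) (by norm_num)]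
    linarith
  have h4 : ‖v‖ ≤ ‖z‖ + 2 * ‖bilin hs isEvenBounded_one a v‖ := by
    conv_lhs => rw [hv]
    refine (norm_sub_le _ _).trans ?_
    rw [norm_smul]
    norm_num
  have h5 := mul_le_mul_of_nonneg_right h3 (norm_nonneg v)
  linarith

/-- The linearizations of `v ↦ v + ∂⁻¹ B(v²)` are bounded below in `H^s`. -/
theorem exists_bddBelow (hs : 0 ≤ s) {C : ℝ} (hC : 1 ≤ C) {ρ : ℝ} (hρ : 0 ≤ ρ) : ∃ K N₀ : ℝ,
    0 < K ∧ ∀ N, N₀ ≤ N → ∀ (b : ℤ → ℝ) (hb : IsEvenBounded b), (∀ k, |b k| ≤ C) →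
    (∀ k : ℤ, |(k : ℝ)| ≤ N / 2 → b k = 1) → ∀ a : realL2, ‖a‖ ≤ ρ → ∀ v : realL2,
    ‖v‖ ≤ K * ‖v + (2 : ℝ) • bilin hs hb a v‖ := by
  obtain ⟨K, hK0, hK⟩ := exists_bddBelow_one hs hρ
  -- With this ε, changing the symbol from 1 to b costs at most ‖v‖/2, whence the constant 2K.
  obtain ⟨N₀, hN₀⟩ := exists_norm_bilin_sub_le hs C (ε := 1 / (4 * K * (ρ + 1))) (by positivity)
  refine ⟨2 * K, N₀, by positivity, fun N hN b hb hbC hb1 a ha v => ?_⟩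
  have h1 := hN₀ N hN 1 b isEvenBounded_one hb (fun k => by simpa using hC) hbC
    (fun k hk => (hb1 k hk).symm) a v
  have h2 := hK a v ha
  have e : v + (2 : ℝ) • bilin hs isEvenBounded_one a v = (v + (2 : ℝ) • bilin hs hb a v) +
      (2 : ℝ) • (bilin hs isEvenBounded_one a v - bilin hs hb a v) := by module
  have h3 := norm_add_le (v + (2 : ℝ) • bilin hs hb a v)
    ((2 : ℝ) • (bilin hs isEvenBounded_one a v - bilin hs hb a v))
  rw [← e, norm_smul, Real.norm_eq_abs, abs_two] at h3
  have h4 : 1 / (4 * K * (ρ + 1)) * (‖a‖ * ‖v‖) ≤ 1 / (4 * K) * ‖v‖ := by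
    calc 1 / (4 * K * (ρ + 1)) * (‖a‖ * ‖v‖) ≤ 1 / (4 * K * (ρ + 1)) * ((ρ + 1) * ‖v‖) := by
          gcongr
          linarith
      _ = _ := by field_simp
  have h5 : K * (1 / (4 * K) * ‖v‖) = ‖v‖ / 4 := by field_simp
  have h6 := mul_le_mul_of_nonneg_left (h3.trans (add_le_add_right
    (mul_le_mul_of_nonneg_left (h1.trans h4) two_pos.le) _)) hK0.le
  linarith

/-- A priori bound for the solutions of `v + ∂⁻¹ B(v²) = y` if the symbol of `B` is nonnegative. -/
theorem exists_apriori_of_nonneg (hs : 0 ≤ s) (hs' : 1 / 2 ≤ s) {C : ℝ} (hC : 0 ≤ C) {R : ℝ}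
    (hR : 0 ≤ R) : ∃ ρ N₀ : ℝ, 0 ≤ ρ ∧ ∀ N, N₀ ≤ N → ∀ (b : ℤ → ℝ) (hb : IsEvenBounded b),
    (∀ k, 0 ≤ b k) → (∀ k, b k ≤ C) → (∀ k : ℤ, |(k : ℝ)| ≤ N / 2 → b k = 1) →
    b.support.Finite → ∀ v : realL2, ‖v + bilin hs hb v v‖ ≤ R → ‖v‖ ≤ ρ := by
  obtain ⟨N₀, Λ, hΛ0, hΛ⟩ := exists_energy_zero_le C (R ^ 2) hC (by positivity)
  -- `r` bounds the L² norm of v = w + y. As in the linear estimate, ε is chosen so that 2εr ≤ 1/2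
  -- and the H^s norm can be absorbed.
  set r : ℝ := R + √Λ with hr
  have hr0 : 0 ≤ r := by positivity
  set ε : ℝ := 1 / (4 * (r + 1)) with hε
  have hε0 : 0 < ε := by positivity
  obtain ⟨A, hA0, hA⟩ := exists_norm_bilin_le hs C hε0
  refine ⟨2 * (R + A * (r * r)), N₀, by positivity,
    fun N hN b hb hb0 hbC hb1 hbs v hv => ?_⟩
  set y := v + bilin hs hb v v with hy
  have hwz : coef s (-bilin hs hb v v) + coef s y = coef s v := by
    rw [← coef_add]
    congr 1
    rw [hy]; abel
  have hneg : coef s (-bilin hs hb v v) = -coef s (bilin hs hb v v) := by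
    ext k
    simp [coef]
  have hL := hΛ N hN b hb0 hbC hb1 hbs (coef s (-bilin hs hb v v)) (coef s y)
    (isRealValued_coef _ _) ((finiteEnergy_coef s y).mono hs') (by
      refine (energy_mono hs' (finiteEnergy_coef s y)).trans ?_
      rw [energy_coef]
      exact pow_le_pow_left₀ (norm_nonneg _) hv 2) (by rw [hwz, hneg, coef_bilin])
  have h0 : ‖toL2 hs v‖ ≤ r := by
    have e : v = -bilin hs hb v v + y := by rw [hy]; abel
    have h1 : ‖toL2 hs (-bilin hs hb v v)‖ ≤ √Λ := by
      refine Real.le_sqrt_of_sq_le ?_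
      rw [norm_toL2_sq]
      exact hL
    have h2 : toL2 hs v = toL2 hs (-bilin hs hb v v) + toL2 hs y := by rw [← toL2_add, ← e]
    rw [h2, hr]
    have h3 := norm_add_le (toL2 hs (-bilin hs hb v v)) (toL2 hs y)
    have h4 := (norm_toL2_le hs y).trans hv
    linarith
  have h1 := hA b hb (fun k => by rw [abs_of_nonneg (hb0 k)]; exact hbC k) v v
  have h2 : ‖bilin hs hb v v‖ ≤ A * (r * r) + ε * (‖v‖ * r + r * ‖v‖) := h1.trans (by gcongr)
  have h3 : ε * r ≤ 1 / 4 := by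
    rw [hε, one_div_mul_eq_div, div_le_div_iff₀ (by positivity) (by norm_num)]
    linarith
  have h4 : ‖v‖ ≤ ‖y‖ + ‖bilin hs hb v v‖ := by
    have e : v = y - bilin hs hb v v := by rw [hy]; abel
    conv_lhs => rw [e]
    exact norm_sub_le _ _
  have h5 := mul_le_mul_of_nonneg_right h3 (norm_nonneg v)
  linarith

end LowerBounds

/-! ### Translation of M_B v = u into the quadratic equation, and its solution. -/

section ModifiedMiura

theorem antideriv_modifiedMiura (b : ℤ → ℝ) {v : Coeffs} (hv : v 0 = 0) :
    antideriv (modifiedMiura b v) = v + antideriv (multiplier b (mul v v)) := by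
  ext k
  by_cases hk : k = 0
  · simp [antideriv, hk, hv]
  · have : Complex.I * (k : ℂ) ≠ 0 := by simp [hk]
    simp only [antideriv, modifiedMiura, deriv, multiplier, mean, Pi.add_apply, Pi.sub_apply, hk,
      if_false]
    field_simp
    ring

/-- At k = 0 the terms B(v²) and P₀(v²) cancel. Thus M_B v has mean zero and nothing is lost by
applying ∂⁻¹. -/
theorem modifiedMiura_zero {b : ℤ → ℝ} (hb : b 0 = 1) (v : Coeffs) : modifiedMiura b v 0 = 0 := by
  simp [modifiedMiura, deriv, multiplier, mean, hb]

theorem antideriv_injOn {u v : Coeffs} (hu : u 0 = 0) (hv : v 0 = 0)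
    (h : antideriv u = antideriv v) : u = v := by
  ext k
  by_cases hk : k = 0
  · rw [hk, hu, hv]
  · exact mul_left_cancel₀ (inv_ne_zero (by simp [hk])) (congrFun h k)

theorem energy_term_antideriv_succ_le (s : ℝ) (u : Coeffs) (k : ℤ) :
    (1 + (k : ℝ) ^ 2) ^ (s + 1) * ‖antideriv u k‖ ^ 2 ≤
      2 * ((1 + (k : ℝ) ^ 2) ^ s * ‖u k‖ ^ 2) := by
  have hk1 := one_add_sq_pos k
  by_cases hk : k = 0
  · simp [antideriv, hk]
  · have hk2 : (1 : ℝ) ≤ (k : ℝ) ^ 2 := by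
      have h : k ^ 2 ≠ 0 := by simp [hk]
      have : (1 : ℤ) ≤ k ^ 2 := by have := sq_nonneg k; omega
      exact_mod_cast this
    have e : ‖antideriv u k‖ ^ 2 = ((k : ℝ) ^ 2)⁻¹ * ‖u k‖ ^ 2 := by simp [antideriv, mul_pow]
    rw [Real.rpow_add_one hk1.ne', e]
    have h1 : (1 + (k : ℝ) ^ 2) * ((k : ℝ) ^ 2)⁻¹ ≤ 2 := by
      rw [← div_eq_mul_inv, div_le_iff₀ (by linarith)]
      linarith
    calc (1 + (k : ℝ) ^ 2) ^ s * (1 + (k : ℝ) ^ 2) * (((k : ℝ) ^ 2)⁻¹ * ‖u k‖ ^ 2)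
        = (1 + (k : ℝ) ^ 2) * ((k : ℝ) ^ 2)⁻¹ * ((1 + (k : ℝ) ^ 2) ^ s * ‖u k‖ ^ 2) := by ring
      _ ≤ _ := mul_le_mul_of_nonneg_right h1 (energy_term_nonneg s u k)

theorem MemHs0.antideriv {s : ℝ} {u : Coeffs} (hu : MemHs0 s u) :
    MemHs0 (s + 1) (TorusSobolev.antideriv u) where
  summable := Summable.of_nonneg_of_le (energy_term_nonneg _ _)
    (energy_term_antideriv_succ_le s u) (hu.summable.mul_left 2)
  real_valued := IsRealValued.antideriv hu.real_valued
  mean_zero := by simp [TorusSobolev.antideriv]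

theorem MemHs0.sub {s : ℝ} {u v : Coeffs} (hu : MemHs0 s u) (hv : MemHs0 s v) :
    MemHs0 s (u - v) := by
  have h := memHs0_coef s (ofCoeffs s u hu - ofCoeffs s v hv)
  rwa [coef_sub, coef_ofCoeffs, coef_ofCoeffs] at h

theorem energy_antideriv_le {s : ℝ} {u : Coeffs} (hu : MemHs0 s u) :
    energy (s + 1) (antideriv u) ≤ 2 * energy s u := by
  rw [energy, energy, ← tsum_mul_left]
  exact hu.antideriv.summable.tsum_le_tsum (energy_term_antideriv_succ_le s u)
    (hu.summable.mul_left 2)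

theorem hsNorm_sq (s : ℝ) (u : Coeffs) : hsNorm s u ^ 2 = 2 * Real.pi * energy s u := by
  rw [hsNorm, mul_pow, Real.sq_sqrt Real.two_pi_pos.le]
  congr 1
  exact Real.sq_sqrt (energy_nonneg s u)

theorem hsNorm_nonneg (s : ℝ) (u : Coeffs) : 0 ≤ hsNorm s u :=
  mul_nonneg (Real.sqrt_nonneg _) (Real.sqrt_nonneg _)

theorem hsNorm_coef (s : ℝ) (x : realL2) : hsNorm s (coef s x) = √(2 * Real.pi) * ‖x‖ := by
  rw [hsNorm]
  congr 1
  change √(energy s (coef s x)) = ‖x‖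
  rw [energy_coef, Real.sqrt_sq (norm_nonneg x)]

theorem norm_le_hsNorm_coef (s : ℝ) (x : realL2) : ‖x‖ ≤ hsNorm s (coef s x) := by
  rw [hsNorm_coef]
  refine le_mul_of_one_le_left (norm_nonneg x) (Real.one_le_sqrt.2 ?_)
  linarith [Real.pi_gt_three]

/-- The factor 2 lost from (1 + k²)/k² ≤ 2 is absorbed by the 2π in `hsNorm`, so the same radius R
serves in the model space. -/
theorem norm_ofCoeffs_antideriv_le {s : ℝ} {u : Coeffs} (hu : MemHs0 s u) :
    ‖ofCoeffs (s + 1) (antideriv u) hu.antideriv‖ ≤ hsNorm s u := by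
  refine le_of_sq_le_sq ?_ (hsNorm_nonneg s u)
  rw [norm_ofCoeffs_sq, hsNorm_sq]
  refine (energy_antideriv_le hu).trans ?_
  gcongr
  · exact energy_nonneg s u
  · linarith [Real.pi_gt_three]

theorem ofCoeffs_antideriv_sub {s : ℝ} {u v : Coeffs} (hu : MemHs0 s u) (hv : MemHs0 s v) :
    ofCoeffs (s + 1) (antideriv u) hu.antideriv - ofCoeffs (s + 1) (antideriv v) hv.antideriv =
      ofCoeffs (s + 1) (antideriv (u - v)) (hu.sub hv).antideriv := by
  apply coef_injective (s + 1)
  rw [coef_sub, coef_ofCoeffs, coef_ofCoeffs, coef_ofCoeffs]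
  ext k
  simp [antideriv, mul_sub]

/-- The equation `M_B v = u` in the model space. -/
theorem modifiedMiura_coef_eq_iff {s : ℝ} (hs : 0 ≤ s + 1) {b : ℤ → ℝ} (hb : IsEvenBounded b)
    (hb0 : b 0 = 1) {u : Coeffs} (hu : MemHs0 s u) (x : realL2) :
    modifiedMiura b (coef (s + 1) x) = u ↔
      x + bilin hs hb x x = ofCoeffs (s + 1) (antideriv u) hu.antideriv := by
  have e : coef (s + 1) (x + bilin hs hb x x) =
      antideriv (modifiedMiura b (coef (s + 1) x)) := by
    rw [coef_add, coef_bilin, antideriv_modifiedMiura b (memHs0_coef _ x).mean_zero]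
  constructor
  · intro h
    apply coef_injective (s + 1)
    rw [e, h, coef_ofCoeffs]
  · intro h
    rw [h, coef_ofCoeffs] at e
    exact antideriv_injOn (modifiedMiura_zero hb0 _) hu.mean_zero e.symm

/-- Existence of solutions of `v + ∂⁻¹ B(v²) = y` with uniform bounds. -/
theorem exists_solution {s : ℝ} (hs : 0 ≤ s) (hs' : 1 / 2 ≤ s) {C : ℝ} (hC : 1 ≤ C) {R : ℝ}
    (hR : 0 ≤ R) : ∃ ρ K N₀ : ℝ, 0 < ρ ∧ 0 < K ∧ ∀ N, N₀ ≤ N → ∀ (b : ℤ → ℝ)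
    (hb : IsEvenBounded b), (∀ k, |b k| ≤ C) → (∀ k : ℤ, |(k : ℝ)| ≤ N / 2 → b k = 1) →
    b.support.Finite →
    (∀ a : realL2, ‖a‖ ≤ ρ → ∀ d, ‖d‖ ≤ K * ‖d + (2 : ℝ) • bilin hs hb a d‖) ∧
    (∀ y : realL2, ‖y‖ ≤ R → ∃ v, ‖v‖ < ρ ∧ v + bilin hs hb v v = y) ∧
    ((∀ k, 0 ≤ b k) → ∀ v : realL2, ‖v + bilin hs hb v v‖ ≤ R → ‖v‖ ≤ ρ) := by
  -- The extra 1 in the data radius leaves room for a change of symbol, whose effect on the ball of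
  -- radius ρ + 1 is made at most 1 below. The ball of radius ρ + 1 turns ‖v‖ ≤ ρ into the strict
  -- bound that continuity requires.
  obtain ⟨ρ, N₁, hρ0, hρ⟩ := exists_apriori_of_nonneg hs hs' (C := C) (by linarith)
    (R := R + 1) (by linarith)
  obtain ⟨K, N₂, hK0, hK⟩ := exists_bddBelow hs hC (ρ := ρ + 1) (by linarith)
  obtain ⟨N₃, hN₃⟩ := exists_norm_bilin_sub_le hs C (ε := 1 / (ρ + 1) ^ 2) (by positivity)
  refine ⟨ρ + 1, K, max N₁ (max N₂ N₃), by linarith, hK0,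
    fun N hN b hb hbC hb1 hbs => ?_⟩
  obtain ⟨hN1, hN23⟩ := max_le_iff.1 hN
  obtain ⟨hN2, hN3⟩ := max_le_iff.1 hN23
  have hlower := hK N hN2 b hb hbC hb1
  refine ⟨hlower, fun y hy => ?_, fun hb0 v hv => ?_⟩
  · refine exists_quadratic_eq (bilin_comm hs hb) (by linarith) hlower (fun v hvρ hvR => ?_) hy
    -- `b` may take negative values, so the a priori bound is applied to the sharp cutoff, which is
    -- nonnegative and agrees with `b` for |k| ≤ N/2.
    have hlow := isEvenBounded_lowSymbol (N / 2)
    have hlow0 (k : ℤ) : 0 ≤ lowSymbol (N / 2) k := by rw [lowSymbol]; split_ifs <;> norm_num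
    have hlowC (k : ℤ) : lowSymbol (N / 2) k ≤ C := by rw [lowSymbol]; split_ifs <;> linarith
    have hlow1 (k : ℤ) (hk : |(k : ℝ)| ≤ N / 2) : lowSymbol (N / 2) k = 1 := if_pos hk
    have hlows : (lowSymbol (N / 2)).support.Finite := by
      refine (Set.finite_Icc (-⌈N / 2⌉) ⌈N / 2⌉).subset fun k hk => ?_
      have hk' : |(k : ℝ)| ≤ N / 2 := by
        by_contra h
        exact hk (if_neg h)
      obtain ⟨h1, h2⟩ := abs_le.1 (hk'.trans (Int.le_ceil _))
      exact ⟨by exact_mod_cast h1, by exact_mod_cast h2⟩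
    have hd := hN₃ N hN3 (lowSymbol (N / 2)) b hlow hb
      (fun k => by rw [abs_of_nonneg (hlow0 k)]; exact hlowC k) hbC
      (fun k hk => by rw [hlow1 k hk, hb1 k hk]) v v
    have hd1 : 1 / (ρ + 1) ^ 2 * (‖v‖ * ‖v‖) ≤ 1 := by
      calc 1 / (ρ + 1) ^ 2 * (‖v‖ * ‖v‖) ≤ 1 / (ρ + 1) ^ 2 * ((ρ + 1) * (ρ + 1)) := by gcongr
        _ = 1 := by field_simp
    have h := hρ N hN1 _ hlow hlow0 hlowC hlow1 hlows v (by
      have e : v + bilin hs hlow v v =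
          (v + bilin hs hb v v) + (bilin hs hlow v v - bilin hs hb v v) := by abel
      rw [e]
      exact (norm_add_le _ _).trans (add_le_add hvR (hd.trans hd1)))
    linarith
  · have h := hρ N hN1 b hb hb0 (fun k => (le_abs_self _).trans (hbC k)) hb1 hbs v (by linarith)
    linarith

end ModifiedMiura

end TorusSobolev

/-! ### The main theorem. -/

open TorusSobolev
theorem mainTheorem8 (s R : ℝ) (hs : -1 / 2 ≤ s) (hR : 0 < R) (C : ℕ → ℝ) :
    ∃ (N₀ L : ℝ) (N₁ : ℝ → ℝ), ∀ N : ℝ, N₀ ≤ N →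
      ∀ β : ℝ → ℝ, TorusSobolev.IsAdaptedBump C N β →
        ∃ Minv : TorusSobolev.Coeffs → TorusSobolev.Coeffs,
          (∀ u ∈ TorusSobolev.ball s R, TorusSobolev.MemHs0 (s + 1) (Minv u) ∧
            TorusSobolev.modifiedMiura (fun k => β k) (Minv u) = u) ∧
          (∀ v, TorusSobolev.MemHs0 (s + 1) v →
            TorusSobolev.modifiedMiura (fun k => β k) v ∈ TorusSobolev.ball s R →
            ((∀ ξ, 0 ≤ β ξ) ∨ ∃ ρ, TorusSobolev.hsNorm (s + 1) v ≤ ρ ∧ N₁ ρ ≤ N) →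
            Minv (TorusSobolev.modifiedMiura (fun k => β k) v) = v) ∧
          (∀ u₁ ∈ TorusSobolev.ball s R, ∀ u₂ ∈ TorusSobolev.ball s R,
            TorusSobolev.hsNorm (s + 1) (Minv u₁ - Minv u₂) ≤
              L * TorusSobolev.hsNorm s (u₁ - u₂)) := by
  have hs0 : 0 ≤ s + 1 := by linarith
  -- `C 0` bounds β; the 1 lets the same constant bound the comparison symbols 1 and the sharp
  -- cutoff.
  set C₀ : ℝ := max (C 0) 1 with hC₀
  have hC₀1 : 1 ≤ C₀ := le_max_right _ _
  obtain ⟨ρ, K, N₂, hρ0, hK0, hsol⟩ := exists_solution hs0 (by linarith) hC₀1 hR.le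
  -- The ball of radius max ρ r contains both the constructed solution and a given v of size r;
  -- N₁(r) is the threshold for the lower bound there.
  choose K' N₁ hK'0 hK' using fun r : ℝ =>
    exists_bddBelow hs0 hC₀1 (ρ := max ρ r) (hρ0.le.trans (le_max_left _ _))
  -- N ≥ 0 ensures β(0) = 1. The factor √(2π) converts the model norm into `hsNorm`.
  refine ⟨max 0 N₂, √(2 * Real.pi) * K, N₁, fun N hN β hβ => ?_⟩
  obtain ⟨hN0, hN2⟩ := max_le_iff.1 hN
  set b : ℤ → ℝ := fun k => β k with hbdef
  have hbC (k : ℤ) : |b k| ≤ C₀ := by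
    have h := hβ.bound 0 k
    simp only [iteratedDeriv_zero, pow_zero, div_one] at h
    exact h.trans (le_max_left _ _)
  have hb : IsEvenBounded b := ⟨fun k => by simp [hbdef, hβ.even], C₀, hbC⟩
  have hb1 (k : ℤ) (hk : |(k : ℝ)| ≤ N / 2) : b k = 1 := hβ.eq_one k hk
  have hb0 : b 0 = 1 := hb1 0 (by simpa using by linarith)
  have hbs : b.support.Finite := by
    refine (Set.finite_Icc (-⌈N⌉) ⌈N⌉).subset fun k hk => ?_
    have hk' : |(k : ℝ)| ≤ N := by
      by_contra h
      exact hk (hβ.eq_zero k (not_le.1 h))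
    obtain ⟨h1, h2⟩ := abs_le.1 (hk'.trans (Int.le_ceil _))
    exact ⟨by exact_mod_cast h1, by exact_mod_cast h2⟩
  obtain ⟨hlower, hex, hpos⟩ := hsol N hN2 b hb hbC hb1 hbs
  -- Off the ball the inverse takes the default value 0.
  have hinv : ∀ u : Coeffs, ∃ x : realL2, ∀ hu : u ∈ ball s R,
      ‖x‖ < ρ ∧ x + bilin hs0 hb x x = ofCoeffs (s + 1) (antideriv u) hu.1.antideriv := by
    intro u
    by_cases hu : u ∈ ball s R
    · obtain ⟨x, hx⟩ := hex _ ((norm_ofCoeffs_antideriv_le hu.1).trans hu.2)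
      exact ⟨x, fun _ => hx⟩
    · exact ⟨0, fun h => absurd h hu⟩
  choose inv hinv using hinv
  refine ⟨fun u => coef (s + 1) (inv u), fun u hu => ⟨memHs0_coef _ _, ?_⟩, ?_, ?_⟩
  · exact (modifiedMiura_coef_eq_iff hs0 hb hb0 hu.1 _).2 (hinv u hu).2
  · intro v hv hu hcase
    obtain ⟨x, rfl⟩ : ∃ x, coef (s + 1) x = v := ⟨_, coef_ofCoeffs _ v hv⟩
    obtain ⟨hy, hyeq⟩ := hinv _ hu
    have hxeq := (modifiedMiura_coef_eq_iff hs0 hb hb0 hu.1 x).1 rfl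
    -- Two solutions with the same data coincide once a lower bound holds on a ball containing both.
    have huniq {r κ : ℝ} (hr : ρ ≤ r) (hx : ‖x‖ ≤ r) (hκ : ∀ a : realL2, ‖a‖ ≤ r →
        ∀ d, ‖d‖ ≤ κ * ‖d + (2 : ℝ) • bilin hs0 hb a d‖) :
        inv (modifiedMiura b (coef (s + 1) x)) = x := by
      have h := norm_sub_le_of_bddBelow (bilin_comm hs0 hb) hκ (hy.le.trans hr) hx
      rw [hyeq, hxeq, sub_self, norm_zero, mul_zero] at h
      exact sub_eq_zero.1 (norm_le_zero_iff.1 h)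
    change coef (s + 1) (inv (modifiedMiura b (coef (s + 1) x))) = _
    congr 1
    -- If β ≥ 0, the a priori bound puts v in the ball of radius ρ; otherwise the assumed bound on v
    -- takes its place.
    rcases hcase with hβ0 | ⟨r, hr, hrN⟩
    · refine huniq le_rfl (hpos (fun k => hβ0 k) x ?_) hlower
      rw [hxeq]
      exact (norm_ofCoeffs_antideriv_le hu.1).trans hu.2
    · exact huniq (le_max_left _ _)
        (((norm_le_hsNorm_coef _ x).trans hr).trans (le_max_right ρ r))
        (hK' r N hrN b hb hbC hb1)
  · intro u₁ hu₁ u₂ hu₂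
    obtain ⟨h1, e1⟩ := hinv u₁ hu₁
    obtain ⟨h2, e2⟩ := hinv u₂ hu₂
    have h := norm_sub_le_of_bddBelow (bilin_comm hs0 hb) hlower h1.le h2.le
    rw [e1, e2, ofCoeffs_antideriv_sub hu₁.1 hu₂.1] at h
    rw [← coef_sub, hsNorm_coef, mul_assoc]
    gcongr
    refine h.trans ?_
    gcongr
    exact norm_ofCoeffs_antideriv_le (hu₁.1.sub hu₂.1)
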